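/- Let $p$ be a prime with $5\le p\le 19$, let $\tau$ be in the upper half plane, $q=e^{2\pi i\tau}$, and $(a;q)_\infty=\prod_{k\ge 0}(1-aq^k)$. For an odd primitive Dirichlet character $\chi$ modulo $p$ put $$E_{1,\chi}(\tau)=1+\frac{2}{L(0,\chi)}\sum_{n=1}^\infty \chi(n)\frac{q^n}{1-q^n},\qquad \mathcal{E}_p(\tau)=\frac{2}{p-1}\sum_{\chi}E_{1,\chi}(\tau),$$ where $L(s,\chi)$ is the analytically continued Dirichlet $L$-function and $\chi$ runs over the odd primitive characters modulo $p$. For an integer $a$ prime to $p$ let $$\mathcal{E}_{a,p}(\tau)=(\langle a\rangle\mathcal{E}_p)(\tau)=(\gamma_{21}\tau+\gamma_{22})^{-1}\,\mathcal{E}_p(\gamma\tau),$$ where $\gamma\in SL(2,\mathbb{Z})$ is any matrix with $\gamma_{21}\equiv 0$ and $\gamma_{22}\equiv a\pmod p$. Let $(a_{k,p})_{k=1}^{(p-1)/2}$ be $(1,2)$ for $p=5$; $(1,2,3)$ for $p=7$; $(1,2,3,5,7)$ for $p=11$; $(1,2,3,4,5,7)$ for $p=13$; $(1,2,3,5,7,8,11,13)$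 for $p=17$; $(1,2,3,4,5,7,9,11,13)$ for $p=19$. Then, for every choice of the matrices $\gamma$, $$\prod_{k=1}^{(p-1)/2}\mathcal{E}_{a_{k,p},p}(\tau)=q^{(p^2-1)/24}\,\frac{(q^p;q^p)_\infty^p}{(q;q)_\infty}.$$ Up to the power of $q$, this is the generating function for $p$-core partitions: $$\sum_{n=0}^\infty c_p(n)q^n=\frac{(q^p;q^p)_\infty^p}{(q;q)_\infty},$$ where $c_p(n)$ is the number of partitions of $n$ that are $p$-cores, i.e. in whose Young diagram no hook number (the number of squares formed by a square, the squares to its right in its row and the squares below it in its column) is a multiple of $p$. -/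

import Mathlib

open scoped MatrixGroups ModularForm

noncomputable section

namespace PCore

/-- `q = e^{2πiτ}`. -/
def nome (τ : UpperHalfPlane) : ℂ :=
  Complex.exp (2 * Real.pi * Complex.I * (τ : ℂ))

/-- The infinite `q`-Pochhammer symbol `(a; q)_∞ = ∏_{k ≥ 0} (1 - a q^k)`. -/
def qPoch (a q : ℂ) : ℂ :=
  ∏' k : ℕ, (1 - a * q ^ k)

/-- For `|q| < 1` the product defining `(a; q)_∞` converges. -/
theorem multipliable_qPoch (a q : ℂ) (hq : ‖q‖ < 1) :
    Multipliable fun k : ℕ => 1 - a * q ^ k := by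
  have h := multipliable_one_add_of_summable (R := ℂ) (f := fun k : ℕ => -(a * q ^ k)) (by
    simpa [norm_mul, norm_pow] using
      (summable_geometric_of_lt_one (norm_nonneg q) hq).mul_left ‖a‖)
  simpa [sub_eq_add_neg] using h

/-- The Eisenstein series
`E_{k,χ}(τ) = 1 + (2 / L(1-k, χ)) ∑_{n ≥ 1} χ(n) n^{k-1} q^n / (1 - q^n)` of weight `k ≥ 1`
twisted by a Dirichlet character modulo `p`; `L(s, χ)` is the analytically continued
`L`-function. -/
def eisenstein {p : ℕ} [NeZero p] (k : ℕ) (χ : DirichletCharacter ℂ p)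
    (τ : UpperHalfPlane) : ℂ :=
  1 + 2 / DirichletCharacter.LFunction χ (1 - (k : ℂ)) *
    ∑' n : ℕ+, χ ((n : ℕ) : ZMod p) *
      (((n : ℕ) : ℂ) ^ (k - 1) * nome τ ^ (n : ℕ) / (1 - nome τ ^ (n : ℕ)))

open scoped Classical in
/-- `𝓔_p = (2 / (p-1)) ∑_χ E_{1,χ}`, the sum over the odd primitive Dirichlet characters
modulo `p`. -/
def eisensteinMean (p : ℕ) [NeZero p] (τ : UpperHalfPlane) : ℂ :=
  2 / ((p : ℂ) - 1) *
    ∑ χ : DirichletCharacter ℂ p with χ.Odd ∧ χ.IsPrimitive, eisenstein 1 χ τ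

/-- The diamond operator in weight `k`:
`(⟨γ⟩ f)(τ) = (γ₂₁ τ + γ₂₂)^{-k} f(γ τ)` for `γ ∈ Γ₀(p)`, that is, the slash action. -/
def diamond {p : ℕ} (k : ℤ) (γ : CongruenceSubgroup.Gamma0 p) (f : UpperHalfPlane → ℂ) :
    UpperHalfPlane → ℂ :=
  f ∣[k] (γ : SL(2, ℤ))

theorem diamond_apply {p : ℕ} (k : ℤ) (γ : CongruenceSubgroup.Gamma0 p)
    (f : UpperHalfPlane → ℂ) (τ : UpperHalfPlane) :
    diamond k γ f τ =
      (((γ : SL(2, ℤ)) 1 0 : ℂ) * (τ : ℂ) + ((γ : SL(2, ℤ)) 1 1 : ℂ)) ^ (-k) *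
        f ((γ : SL(2, ℤ)) • τ) := by
  rw [diamond, ModularForm.SL_slash_apply, mul_comm]
  simp [UpperHalfPlane.denom]

/-- The matrix `γ ∈ Γ₀(p)` represents the diamond operator `⟨a⟩`: its lower right entry is
congruent to `a` modulo `p`. -/
def Represents {p : ℕ} (γ : CongruenceSubgroup.Gamma0 p) (a : ℕ) : Prop :=
  (((γ : SL(2, ℤ)) 1 1 : ℤ) : ZMod p) = (a : ZMod p)

/-- Every residue prime to `p` has a representing matrix in `Γ₀(p)`. -/
theorem exists_represents {p a : ℕ} (h : Nat.Coprime a p) :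
    ∃ γ : CongruenceSubgroup.Gamma0 p, Represents γ a := by
  have hb : (1 : ℤ) = (a : ℤ) * Nat.gcdA a p + (p : ℤ) * Nat.gcdB a p := by
    have := Nat.gcd_eq_gcd_ab a p
    rwa [Nat.Coprime.gcd_eq_one h, Nat.cast_one] at this
  have hdet : (!![Nat.gcdA a p, -Nat.gcdB a p; (p : ℤ), (a : ℤ)]).det = 1 := by
    rw [Matrix.det_fin_two_of]
    linarith
  let g : SL(2, ℤ) := ⟨!![Nat.gcdA a p, -Nat.gcdB a p; (p : ℤ), (a : ℤ)], hdet⟩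
  have h10 : g 1 0 = (p : ℤ) := rfl
  have h11 : g 1 1 = (a : ℤ) := rfl
  have hg : g ∈ CongruenceSubgroup.Gamma0 p := by
    rw [CongruenceSubgroup.Gamma0_mem, h10]
    simp
  refine ⟨⟨g, hg⟩, ?_⟩
  change ((g 1 1 : ℤ) : ZMod p) = (a : ZMod p)
  rw [h11]
  simp

/-- The `(p-1)/2` indices `a_{1,p}, a_{2,p}, …` for the primes `5 ≤ p ≤ 19`. -/
def genIndices : ℕ → Finset ℕ
  | 5 => {1, 2}
  | 7 => {1, 2, 3}
  | 11 => {1, 2, 3, 5, 7}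
  | 13 => {1, 2, 3, 4, 5, 7}
  | 17 => {1, 2, 3, 5, 7, 8, 11, 13}
  | 19 => {1, 2, 3, 4, 5, 7, 9, 11, 13}
  | _ => ∅

/-- The hook of the square `c` of a Young diagram: `c` itself, the squares of its row to the
right of `c`, and the squares of its column below `c`. -/
def hook (μ : YoungDiagram) (c : ℕ × ℕ) : Finset (ℕ × ℕ) :=
  μ.cells.filter fun d => (d.1 = c.1 ∧ c.2 ≤ d.2) ∨ (d.2 = c.2 ∧ c.1 ≤ d.1)

/-- A partition, given by its Young diagram, is a `t`-core if no hook number is a multiple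
of `t`. -/
def IsCore (t : ℕ) (μ : YoungDiagram) : Prop :=
  ∀ c ∈ μ.cells, ¬ t ∣ (hook μ c).card

/-- `c_t(n)`, the number of partitions of `n` that are `t`-cores. -/
def coreCount (t n : ℕ) : ℕ :=
  {μ : YoungDiagram | μ.card = n ∧ IsCore t μ}.ncard

/-- There are finitely many partitions of `n`, so `coreCount` counts a finite set. -/
theorem finite_cores (t n : ℕ) :
    {μ : YoungDiagram | μ.card = n ∧ IsCore t μ}.Finite := by
  have key : ∀ μ : YoungDiagram, ∀ c ∈ μ.cells, c.1 < μ.card ∧ c.2 < μ.card := by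
    intro μ c hc
    constructor
    · have hsub : (Finset.range (c.1 + 1)).image (fun i => (i, c.2)) ⊆ μ.cells := by
        intro d hd
        obtain ⟨i, hi, rfl⟩ := Finset.mem_image.mp hd
        exact μ.up_left_mem (Nat.lt_succ_iff.mp (Finset.mem_range.mp hi)) le_rfl hc
      have := Finset.card_le_card hsub
      rw [Finset.card_image_of_injective _ (fun x y h => congrArg Prod.fst h),
        Finset.card_range] at this
      exact this
    · have hsub : (Finset.range (c.2 + 1)).image (fun j => (c.1, j)) ⊆ μ.cells := by
        intro d hd
        obtain ⟨j, hj, rfl⟩ := Finset.mem_image.mp hd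
        exact μ.up_left_mem le_rfl (Nat.lt_succ_iff.mp (Finset.mem_range.mp hj)) hc
      have := Finset.card_le_card hsub
      rw [Finset.card_image_of_injective _ (fun x y h => congrArg Prod.snd h),
        Finset.card_range] at this
      exact this
  refine Set.Finite.of_finite_image (f := YoungDiagram.cells)
    (((Finset.range n ×ˢ Finset.range n).powerset.finite_toSet).subset ?_)
    (fun μ _ ν _ h => YoungDiagram.ext h)
  rintro _ ⟨μ, ⟨rfl, -⟩, rfl⟩
  simp only [Finset.coe_powerset, Set.mem_preimage, Set.mem_powerset_iff]
  intro c hc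
  have := key μ c hc
  simpa using this

end PCore

end

/-! ### Infinite products, theta function and the function J -/

noncomputable section
namespace PCore
open Complex Filter Topology Set

/-! Let T = pτ, let θ be the theta function with simple zeros on ℤ + ℤT, and J = 1/2 - θ'/(2πiθ),
which is odd, has period 1 and satisfies J(x + T) = J(x) + 1. For each p there is a quadruple b of
integers of sum 0 with L(0, χ) ∑ χ(bᵢ)⁻¹ = 2 for every odd χ; since L(0, χ) = ∑ χ(j)(1/2 - j/p),
this is a condition on the residues of the k bᵢ (`IsBalanced`). In the mean over χ, orthogonality
leaves the Lambert series over n ≡ ±bᵢ mod p, so that 𝓔_p = ∑ J(bᵢτ) (`eisensteinMean_eq`).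

Because ∑ bᵢ = 0, the sum of the J(bᵢτ) is an absolutely convergent lattice sum
(`tsum_latticeTerm`), homogeneous of degree -1. Hence ⟨a⟩ replaces bᵢ by k bᵢ, where k a ≡ 1 mod p
(`diamond_eisensteinMean`). By the addition formula for J (`zetaQ_sum_eq`), each ⟨a⟩𝓔_p is (q^p;
q^p)² times three values of θ over four, all at points kcτ with c among seven integers prime to p.

As a varies, the k form a half system modulo p, so for each c the values at kcτ multiply, up to sign
and powers of q, to the same product P. Three such products over four leave 1/P, and P is (q;
q)/(q^p; q^p) up to a power of q (`prod_thetaInt_Icc`). The existence of b and the signs are finite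
checks for each prime.

For the cores, a Young diagram is encoded by a Maya diagram, in which hook numbers are differences
between an element and a smaller gap (`isCore_iff`). Splitting it by residues modulo p gives charges
of sum 0 and p quotient diagrams (`bijective_abacus`); cores are the diagrams with empty quotients,
and a quotient square costs p squares (`card_ofAbacus`). So Euler's series 1/(q; q) is the series of
the cores times (q^p; q^p)^(-p). -/

theorem multipliableLocallyUniformlyOn_qPoch {q : ℂ} (hq : ‖q‖ < 1) :
    MultipliableLocallyUniformlyOn (fun (k : ℕ) (a : ℂ) => 1 - a * q ^ k) univ := by
  use fun a => ∏' k : ℕ, (1 - a * q ^ k)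
  simp_rw [sub_eq_add_neg]
  apply hasProdLocallyUniformlyOn_of_forall_compact isOpen_univ
  intro K _ hcK
  obtain ⟨R, hR⟩ := hcK.isBounded.exists_norm_le
  refine ((summable_geometric_of_lt_one (norm_nonneg q) hq).mul_left R).hasProdUniformlyOn_nat_one_add
      hcK (.of_forall fun n x hx => ?_) (fun _ => by fun_prop)
  rw [norm_neg, norm_mul, norm_pow]
  exact mul_le_mul_of_nonneg_right (hR x hx) (by positivity)

theorem differentiable_qPoch {q : ℂ} (hq : ‖q‖ < 1) : Differentiable ℂ fun a => qPoch a q := by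
  rw [← differentiableOn_univ]
  exact (multipliableLocallyUniformlyOn_qPoch hq).hasProdLocallyUniformlyOn.differentiableOn
    (.of_forall fun _ => by simpa [Finset.prod_fn] using
      DifferentiableOn.finsetProd (fun _ _ => by fun_prop)) isOpen_univ

theorem qPoch_eq_one_sub_mul {q : ℂ} (hq : ‖q‖ < 1) (a : ℂ) :
    qPoch a q = (1 - a) * qPoch (q * a) q := by
  have h := multipliable_qPoch a q hq
  have h' := multipliable_qPoch (q * a) q hq
  have h2 : Tendsto (fun n => ∏ k ∈ Finset.range (n + 1), (1 - a * q ^ k)) atTop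
      (𝓝 (qPoch a q)) := (h.hasProd.tendsto_prod_nat).comp (tendsto_add_atTop_nat 1)
  have h3 := h'.hasProd.tendsto_prod_nat.const_mul (1 - a)
  refine tendsto_nhds_unique h2 (h3.congr fun n => ?_)
  rw [Finset.prod_range_succ', mul_comm]
  simp only [pow_zero, mul_one]
  congr 1
  exact Finset.prod_congr rfl fun k _ => by ring

theorem qPoch_ne_zero {a q : ℂ} (hq : ‖q‖ < 1) (h : ∀ k : ℕ, a * q ^ k ≠ 1) : qPoch a q ≠ 0 := by
  simp only [qPoch, sub_eq_add_neg]
  apply tprod_one_add_ne_zero_of_summable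
  · intro k hk
    exact h k (by linear_combination -hk)
  · simpa [norm_mul, norm_pow] using
      (summable_geometric_of_lt_one (norm_nonneg q) hq).mul_left ‖a‖

theorem qPoch_self_ne_zero {q : ℂ} (hq : ‖q‖ < 1) : qPoch q q ≠ 0 := by
  refine qPoch_ne_zero hq fun k hk => ?_
  have h := congrArg norm hk
  rw [← pow_succ', norm_pow, norm_one] at h
  exact (pow_lt_one₀ (norm_nonneg q) hq k.succ_ne_zero).ne h

/-- No condition on `a` is needed: for large k the denominator has norm at least 1/2, and a
vanishing one contributes 0 by the convention on division. -/
theorem summable_div_one_sub {q : ℂ} (hq : ‖q‖ < 1) (a : ℂ) :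
    Summable fun k : ℕ => a * q ^ k / (1 - a * q ^ k) := by
  have hs : Summable fun k : ℕ => a * q ^ k :=
    (summable_geometric_of_norm_lt_one hq).mul_left a
  refine Summable.of_norm_bounded_eventually_nat (g := fun k => 2 * ‖a * q ^ k‖)
    (hs.norm.mul_left 2) ?_
  filter_upwards [hs.tendsto_atTop_zero.norm.eventually_lt_const
    (show ‖(0 : ℂ)‖ < 1 / 2 by norm_num)] with k hk
  have h1 : 1 / 2 ≤ ‖1 - a * q ^ k‖ := by
    have := norm_sub_norm_le (1 : ℂ) (a * q ^ k)
    rw [norm_one] at this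
    linarith
  rw [norm_div, div_le_iff₀ (by linarith)]
  nlinarith [norm_nonneg (a * q ^ k)]

theorem logDeriv_qPoch {a q : ℂ} (hq : ‖q‖ < 1) (h : ∀ k : ℕ, a * q ^ k ≠ 1) :
    a * logDeriv (fun b => qPoch b q) a = -∑' k : ℕ, a * q ^ k / (1 - a * q ^ k) := by
  have hd : ∀ k : ℕ, a * logDeriv (fun b => 1 - b * q ^ k) a
      = -(a * q ^ k / (1 - a * q ^ k)) := by
    intro k
    rw [logDeriv_apply]
    have : deriv (fun b => 1 - b * q ^ k) a = -q ^ k := by simp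
    rw [this]
    ring
  have hs : Summable fun k : ℕ => logDeriv (fun b => 1 - b * q ^ k) a := by
    rcases eq_or_ne a 0 with rfl | ha
    · have : ∀ k : ℕ, logDeriv (fun b => 1 - b * q ^ k) 0 = -q ^ k := by
        intro k; simp [logDeriv_apply]
      simp only [this]
      exact (summable_geometric_of_norm_lt_one hq).neg
    · rw [← summable_mul_left_iff ha]
      simp only [hd]
      exact (summable_div_one_sub hq a).neg
  have := logDeriv_tprod_eq_tsum isOpen_univ (mem_univ a)
    (f := fun (k : ℕ) (a : ℂ) => 1 - a * q ^ k) (fun k => sub_ne_zero.2 (h k).symm)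
    (fun k => by fun_prop) hs (multipliableLocallyUniformlyOn_qPoch hq) (qPoch_ne_zero hq h)
  unfold qPoch
  rw [this, ← tsum_mul_left, ← tsum_neg]
  exact tsum_congr hd

/-- The normalized exponential `e(x) = e^{2πix}`. -/
def expo (x : ℂ) : ℂ := exp (2 * Real.pi * I * x)

theorem expo_add (x y : ℂ) : expo (x + y) = expo x * expo y := by
  rw [expo, mul_add, exp_add, expo, expo]

theorem expo_zero : expo 0 = 1 := by simp [expo]

theorem expo_ne_zero (x : ℂ) : expo x ≠ 0 := exp_ne_zero _

theorem expo_neg (x : ℂ) : expo (-x) = (expo x)⁻¹ := by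
  rw [expo, mul_neg, exp_neg, expo]

theorem expo_one : expo 1 = 1 := by simp [expo, exp_two_pi_mul_I]

theorem expo_nat_mul (n : ℕ) (x : ℂ) : expo (n * x) = expo x ^ n := by
  rw [expo, expo, ← exp_nat_mul]
  congr 1; ring

theorem expo_eq_one_iff (x : ℂ) : expo x = 1 ↔ ∃ n : ℤ, x = n := by
  rw [expo, exp_eq_one_iff]
  have h : (2 * Real.pi * I : ℂ) ≠ 0 := two_pi_I_ne_zero
  refine exists_congr fun n => ⟨fun H => mul_left_cancel₀ h (by rw [H]; ring), fun H => by
    rw [H]; ring⟩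

theorem norm_expo_lt_one {T : ℂ} (hT : 0 < T.im) : ‖expo T‖ < 1 := by
  rw [expo, norm_exp, Real.exp_lt_one_iff]
  simp
  positivity

theorem differentiable_expo : Differentiable ℂ expo := by
  unfold expo; fun_prop

theorem hasDerivAt_expo (x : ℂ) : HasDerivAt expo (2 * Real.pi * I * expo x) x := by
  have := ((hasDerivAt_id x).const_mul (2 * Real.pi * I)).cexp
  simp only [id, mul_one] at this
  rw [mul_comm]
  exact this

/-- The theta function `(w; Q)_∞ (Q / w; Q)_∞` with `w = e(x)` and `Q = e(T)`. -/
def theta (T x : ℂ) : ℂ :=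
  qPoch (expo x) (expo T) * qPoch (expo T * expo (-x)) (expo T)

/-- `N = θ / 2 - θ' / (2πi)`, the numerator of the function `zetaQ`. -/
def thetaNum (T x : ℂ) : ℂ := theta T x / 2 - deriv (theta T) x / (2 * Real.pi * I)

/-- The quasi-periodic function `J = 1/2 - θ' / (2πi θ)` with simple poles on `ℤ + ℤT`. -/
def zetaQ (T x : ℂ) : ℂ := thetaNum T x / theta T x

/-! ### Quasi-periodicity and zeros of theta -/

section
variable {T : ℂ} (hT : 0 < T.im)
include hT

theorem differentiable_theta : Differentiable ℂ (theta T) := by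
  have hq := norm_expo_lt_one hT
  unfold theta
  have h1 : Differentiable ℂ fun x => qPoch (expo x) (expo T) :=
    (differentiable_qPoch hq).comp differentiable_expo
  have h2 : Differentiable ℂ fun x => qPoch (expo T * expo (-x)) (expo T) :=
    (differentiable_qPoch hq).comp ((differentiable_expo.comp differentiable_neg).const_mul _)
  exact h1.mul h2

theorem differentiable_thetaNum : Differentiable ℂ (thetaNum T) := by
  have h := differentiable_theta hT
  have h' : Differentiable ℂ (deriv (theta T)) := by
    rw [← differentiableOn_univ] at h ⊢
    exact h.deriv isOpen_univ
  exact (h.div_const _).sub (h'.div_const _)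

/-- The last two factors together are even in x, so both the reflection law and the derivative at 0
come from 1 - e(x) alone. -/
theorem theta_eq (x : ℂ) : theta T x = (1 - expo x) *
    (qPoch (expo T * expo x) (expo T) * qPoch (expo T * expo (-x)) (expo T)) := by
  rw [theta, qPoch_eq_one_sub_mul (norm_expo_lt_one hT)]
  ring

omit hT in
theorem theta_add_one (x : ℂ) : theta T (x + 1) = theta T x := by
  rw [theta, theta, neg_add, expo_add, expo_add, expo_neg 1, expo_one]
  simp

theorem theta_neg (x : ℂ) : theta T (-x) = -expo (-x) * theta T x := by
  rw [theta_eq hT, theta_eq hT, neg_neg, expo_neg]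
  have := expo_ne_zero x
  field_simp
  ring

theorem theta_add_period (x : ℂ) : theta T (x + T) = -expo (-x) * theta T x := by
  have hT0 := expo_ne_zero T
  have hx := expo_ne_zero x
  rw [theta_eq hT x, theta, expo_add, neg_add, expo_add, expo_neg T,
    show expo T * (expo (-x) * (expo T)⁻¹) = expo (-x) by field_simp,
    qPoch_eq_one_sub_mul (norm_expo_lt_one hT) (expo (-x)), expo_neg]
  rw [mul_comm (expo x) (expo T)]
  field_simp
  ring

omit hT in
theorem deriv_theta_add_one (x : ℂ) : deriv (theta T) (x + 1) = deriv (theta T) x := by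
  rw [← deriv_comp_add_const]
  congr 1
  exact funext fun y => theta_add_one y

theorem deriv_theta_add_period (x : ℂ) : deriv (theta T) (x + T) =
    2 * Real.pi * I * expo (-x) * theta T x - expo (-x) * deriv (theta T) x := by
  rw [← deriv_comp_add_const]
  have h : (fun y => theta T (y + T)) = fun y => -expo (-y) * theta T y :=
    funext fun y => theta_add_period hT y
  rw [h]
  have h1 : HasDerivAt (fun y => -expo (-y)) (2 * Real.pi * I * expo (-x)) x := by
    have := ((hasDerivAt_expo (-x)).comp x (hasDerivAt_neg x)).neg
    simpa using! this
  rw [(h1.fun_mul (differentiable_theta hT x).hasDerivAt).deriv]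
  ring

theorem deriv_theta_neg (x : ℂ) : deriv (theta T) (-x) =
    expo (-x) * deriv (theta T) x - 2 * Real.pi * I * expo (-x) * theta T x := by
  have h : (fun y => theta T (-y)) = fun y => -expo (-y) * theta T y :=
    funext fun y => theta_neg hT y
  have h1 : HasDerivAt (fun y => -expo (-y)) (2 * Real.pi * I * expo (-x)) x := by
    have := ((hasDerivAt_expo (-x)).comp x (hasDerivAt_neg x)).neg
    simpa using! this
  have h2 := deriv_comp_neg (theta T) x
  rw [h, (h1.fun_mul (differentiable_theta hT x).hasDerivAt).deriv] at h2
  linear_combination h2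

omit hT in
theorem thetaNum_add_one (x : ℂ) : thetaNum T (x + 1) = thetaNum T x := by
  rw [thetaNum, theta_add_one, deriv_theta_add_one, thetaNum]

theorem thetaNum_add_period (x : ℂ) :
    thetaNum T (x + T) = -expo (-x) * (thetaNum T x + theta T x) := by
  have := two_pi_I_ne_zero
  rw [thetaNum, theta_add_period hT, deriv_theta_add_period hT, thetaNum]
  field_simp
  ring

/-- The summand θ/2 in N absorbs the derivative of the factor e(-x) in the reflection law of θ; this
is what makes J odd. -/
theorem thetaNum_neg (x : ℂ) : thetaNum T (-x) = expo (-x) * thetaNum T x := by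
  have := two_pi_I_ne_zero
  rw [thetaNum, theta_neg hT, deriv_theta_neg hT, thetaNum]
  field_simp
  ring

theorem theta_zero : theta T 0 = 0 := by
  rw [theta_eq hT, expo_zero]; simp

/-- This value becomes the constant of the addition formula. -/
theorem thetaNum_zero : thetaNum T 0 = qPoch (expo T) (expo T) ^ 2 := by
  have hq := norm_expo_lt_one hT
  have h2 := two_pi_I_ne_zero
  have h : theta T = fun x => (1 - expo x) *
      (qPoch (expo T * expo x) (expo T) * qPoch (expo T * expo (-x)) (expo T)) :=
    funext (theta_eq hT)
  have h1 : HasDerivAt (fun x => 1 - expo x) (-(2 * Real.pi * I * expo 0)) 0 :=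
    (hasDerivAt_expo 0).const_sub 1
  have h3 : Differentiable ℂ fun x =>
      qPoch (expo T * expo x) (expo T) * qPoch (expo T * expo (-x)) (expo T) :=
    ((differentiable_qPoch hq).comp (differentiable_expo.const_mul _)).mul
      ((differentiable_qPoch hq).comp ((differentiable_expo.comp differentiable_neg).const_mul _))
  have h4 := (h1.mul (h3 0).hasDerivAt).deriv
  rw [thetaNum, theta_zero hT, h]
  erw [h4]
  simp only [expo_zero, neg_zero, mul_one]
  field_simp
  ring

omit hT in
theorem theta_add_int (x : ℂ) (n : ℤ) : theta T (x + n) = theta T x := by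
  have h : Function.Periodic (theta T) 1 := theta_add_one
  simpa using h.int_mul n x

omit hT in
theorem thetaNum_add_int (x : ℂ) (n : ℤ) : thetaNum T (x + n) = thetaNum T x := by
  have h : Function.Periodic (thetaNum T) 1 := thetaNum_add_one
  simpa using h.int_mul n x

theorem theta_add_lattice_eq_zero_iff (x : ℂ) (m n : ℤ) :
    theta T (x + (m * T + n)) = 0 ↔ theta T x = 0 := by
  rw [← add_assoc, theta_add_int]
  have step : ∀ y, theta T (y + T) = 0 ↔ theta T y = 0 := fun y => by
    rw [theta_add_period hT]; simp [expo_ne_zero]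
  induction m with
  | zero => simp
  | succ k ih =>
    refine Iff.trans ?_ ((step _).trans ih)
    push_cast; ring_nf
  | pred k ih =>
    refine Iff.trans (step _).symm (Iff.trans ?_ ih)
    push_cast; ring_nf

theorem theta_ne_zero {x : ℂ} (hx : ∀ m n : ℤ, x ≠ m * T + n) : theta T x ≠ 0 := by
  have hq := norm_expo_lt_one hT
  apply mul_ne_zero
  · apply qPoch_ne_zero hq
    intro k hk
    rw [← expo_nat_mul, ← expo_add, expo_eq_one_iff] at hk
    obtain ⟨n, hn⟩ := hk
    exact hx (-k) n (by push_cast; linear_combination hn)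
  · apply qPoch_ne_zero hq
    intro k hk
    rw [← expo_nat_mul, ← expo_add, ← expo_add, expo_eq_one_iff] at hk
    obtain ⟨n, hn⟩ := hk
    exact hx (k + 1) (-n) (by push_cast; linear_combination -hn)

theorem theta_eq_zero_iff (x : ℂ) : theta T x = 0 ↔ ∃ m n : ℤ, x = m * T + n := by
  constructor
  · intro h
    by_contra! hx
    exact theta_ne_zero hT hx h
  · rintro ⟨m, n, rfl⟩
    have := (theta_add_lattice_eq_zero_iff hT 0 m n).2 (theta_zero hT)
    rwa [zero_add] at this

/-- At a zero of θ the correction in `thetaNum_add_period` vanishes, so nonvanishing is carried from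
0 to the whole lattice. As N is there a multiple of θ', all zeros of θ are simple. -/
theorem thetaNum_ne_zero {x : ℂ} (hx : theta T x = 0) : thetaNum T x ≠ 0 := by
  obtain ⟨m, n, rfl⟩ := (theta_eq_zero_iff hT x).1 hx
  rw [thetaNum_add_int]
  have step : ∀ y, theta T y = 0 → (thetaNum T (y + T) ≠ 0 ↔ thetaNum T y ≠ 0) := fun y hy => by
    rw [thetaNum_add_period hT, hy]; simp [expo_ne_zero]
  have hz : ∀ m : ℤ, theta T (m * T) = 0 := fun m =>
    (theta_eq_zero_iff hT _).2 ⟨m, 0, by simp⟩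
  clear hx
  induction m with
  | zero =>
    simp only [Int.cast_zero, zero_mul, thetaNum_zero hT]
    exact pow_ne_zero _ (qPoch_self_ne_zero (norm_expo_lt_one hT))
  | succ k ih =>
    have := (step _ (hz k)).2 ih
    convert this using 2
    push_cast; ring
  | pred k ih =>
    apply (step _ (hz _)).1
    convert ih using 2
    push_cast; ring

theorem deriv_theta_ne_zero {x : ℂ} (hx : theta T x = 0) : deriv (theta T) x ≠ 0 := by
  intro h
  exact thetaNum_ne_zero hT hx (by rw [thetaNum, hx, h]; simp)

omit hT in
theorem zetaQ_add_int (x : ℂ) (n : ℤ) : zetaQ T (x + n) = zetaQ T x := by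
  rw [zetaQ, thetaNum_add_int, theta_add_int, zetaQ]

theorem zetaQ_neg (x : ℂ) : zetaQ T (-x) = -zetaQ T x := by
  have := expo_ne_zero (-x)
  rw [zetaQ, thetaNum_neg hT, theta_neg hT, zetaQ, neg_mul, div_neg, mul_div_mul_left _ _ this]

theorem zetaQ_add_period {x : ℂ} (hx : theta T x ≠ 0) : zetaQ T (x + T) = zetaQ T x + 1 := by
  have := expo_ne_zero (-x)
  rw [zetaQ, thetaNum_add_period hT, theta_add_period hT, zetaQ,
    mul_div_mul_left _ _ (neg_ne_zero.2 this), add_div, div_self hx]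

theorem zetaQ_add_int_mul_period {x : ℂ} (hx : theta T x ≠ 0) (m : ℤ) :
    zetaQ T (x + m * T) = zetaQ T x + m := by
  have hz : ∀ m : ℤ, theta T (x + m * T) ≠ 0 := fun m => by
    have := theta_add_lattice_eq_zero_iff hT x m 0
    rw [Int.cast_zero, add_zero] at this
    rwa [Ne, this]
  induction m with
  | zero => simp
  | succ k ih =>
    have := zetaQ_add_period hT (hz k)
    rw [ih] at this
    push_cast at this ⊢
    rw [add_mul, one_mul, ← add_assoc, this]; ring
  | pred k ih =>
    have := zetaQ_add_period hT (hz (-k - 1))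
    rw [show x + ((-k - 1 : ℤ) : ℂ) * T + T = x + ((-k : ℤ) : ℂ) * T by push_cast; ring, ih] at this
    push_cast at this ⊢
    linear_combination -this

/-- Logarithmic differentiation of the two products that define θ; the sign of the second series
comes from the inner derivative of e(-x). -/
theorem zetaQ_eq_tsum {x : ℂ} (hx : theta T x ≠ 0) : zetaQ T x = 1 / 2 +
    ∑' k : ℕ, expo x * expo T ^ k / (1 - expo x * expo T ^ k) -
    ∑' k : ℕ, expo T * expo (-x) * expo T ^ k / (1 - expo T * expo (-x) * expo T ^ k) := by
  have hq := norm_expo_lt_one hT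
  have h2 := two_pi_I_ne_zero
  obtain ⟨h3, h4⟩ := mul_ne_zero_iff.1 hx
  have hne : ∀ a : ℂ, qPoch a (expo T) ≠ 0 → ∀ k : ℕ, a * expo T ^ k ≠ 1 := by
    intro a ha k hk
    apply ha
    rw [qPoch]
    exact tprod_of_exists_eq_zero ⟨k, by rw [hk, sub_self]⟩
  have l1 := logDeriv_qPoch hq (hne _ h3)
  have l2 := logDeriv_qPoch hq (hne _ h4)
  have d1 : HasDerivAt (fun y => qPoch (expo y) (expo T)) _ x :=
    (differentiable_qPoch hq (expo x)).hasDerivAt.comp x (hasDerivAt_expo x)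
  have d2 : HasDerivAt (fun y => qPoch (expo T * expo (-y)) (expo T)) _ x :=
    ((differentiable_qPoch hq (expo T * expo (-x))).hasDerivAt.comp x
      (((hasDerivAt_expo (-x)).comp x (hasDerivAt_neg x)).const_mul (expo T)) :)
  have d3 : deriv (theta T) x = _ := (d1.mul d2).deriv
  rw [logDeriv_apply] at l1 l2
  rw [zetaQ, thetaNum, d3, sub_div, div_right_comm, div_self hx, ← sub_eq_zero]
  rw [neg_eq_iff_eq_neg.symm] at l1 l2
  rw [← l1, ← l2]
  unfold theta
  field_simp
  ring

end
end PCore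

end

/-! ### Liouville's theorem and the addition formula for J -/

noncomputable section
namespace PCore
open Complex Filter Topology Set

/-- An entire function is divisible by an entire function with simple zeros at which it
vanishes. -/
theorem exists_differentiable_eq_mul {f g : ℂ → ℂ} (hf : Differentiable ℂ f)
    (hg : Differentiable ℂ g) (h : ∀ x, g x = 0 → f x = 0 ∧ deriv g x ≠ 0) :
    ∃ u : ℂ → ℂ, Differentiable ℂ u ∧ ∀ x, f x = u x * g x := by
  classical
  -- The singularities are filled in by l'Hôpital's rule; near a zero of g the function agrees with
  -- the quotient of the slopes of f and g at that zero.
  refine ⟨fun x => if g x = 0 then deriv f x / deriv g x else f x / g x, fun x => ?_, fun x => ?_⟩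
  · by_cases hx : g x = 0
    · obtain ⟨hfx, hgx⟩ := h x hx
      have hd : ∀ {k : ℂ → ℂ}, Differentiable ℂ k → Differentiable ℂ (dslope k x) := by
        intro k hk
        rw [← differentiableOn_univ] at hk ⊢
        exact (differentiableOn_dslope univ_mem).2 hk
      have hne : dslope g x x ≠ 0 := by rwa [dslope_same]
      refine (((hd hf x).div (hd hg x) hne)).congr_of_eventuallyEq ?_
      filter_upwards [(hd hg).continuous.continuousAt.eventually_ne hne] with y hy
      rcases eq_or_ne y x with rfl | hyx
      · simp [hx, dslope_same]
      · have e : ∀ k : ℂ → ℂ, k x = 0 → k y = (y - x) * dslope k x y := by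
          intro k hk
          have := sub_smul_dslope k x y
          rw [hk, sub_zero, smul_eq_mul] at this
          exact this.symm
        have hy0 : g y ≠ 0 := by
          rw [e g hx]
          exact mul_ne_zero (sub_ne_zero.2 hyx) hy
        rw [if_neg hy0, e f hfx, e g hx, Pi.div_apply, mul_div_mul_left _ _ (sub_ne_zero.2 hyx)]
    · refine ((hf x).div (hg x) hx).congr_of_eventuallyEq ?_
      filter_upwards [hg.continuous.continuousAt.eventually_ne hx] with y hy
      rw [if_neg hy, Pi.div_apply]
  · by_cases hx : g x = 0
    · simp [hx, (h x hx).1]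
    · simp [hx]

/-- An entire function with the periods `1` and `T` is constant. -/
theorem eq_of_differentiable_of_periodic {T : ℂ} (hT : 0 < T.im) {u : ℂ → ℂ}
    (hu : Differentiable ℂ u) (h1 : Function.Periodic u 1) (h2 : Function.Periodic u T) (x y : ℂ) :
    u x = u y := by
  refine hu.apply_eq_apply_of_bounded ?_ x y
  -- A closed period parallelogram: it is compact, and every value of u is taken on it.
  let K : Set ℂ := (fun v : ℝ × ℝ => (v.1 : ℂ) + v.2 * T) '' (Icc 0 1 ×ˢ Icc 0 1)
  have hK : IsCompact K := (isCompact_Icc.prod isCompact_Icc).image (by fun_prop)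
  refine (hK.image hu.continuous).isBounded.subset ?_
  rintro _ ⟨z, rfl⟩
  let s : ℝ := z.im / T.im
  let r : ℝ := z.re - s * T.re
  have hz : z = r + s * T := by
    apply Complex.ext
    · simp [r]
    · simp [s, hT.ne']
  refine ⟨Int.fract r + Int.fract s * T, ⟨(Int.fract r, Int.fract s), ⟨⟨Int.fract_nonneg _,
    (Int.fract_lt_one _).le⟩, ⟨Int.fract_nonneg _, (Int.fract_lt_one _).le⟩⟩, rfl⟩, ?_⟩
  have e : (Int.fract r + Int.fract s * T : ℂ) = z - ⌊s⌋ * T - ⌊r⌋ * 1 := by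
    rw [hz, Int.fract, Int.fract]
    push_cast
    ring
  rw [e, h1.sub_int_mul_eq, h2.sub_int_mul_eq]

/-- u vanishes near a point where g does not, hence everywhere by the identity theorem. It serves to
transfer the periods of f/g to the entire quotient u. -/
theorem Differentiable.eq_zero_of_mul_eq_zero {u g : ℂ → ℂ} (hu : Differentiable ℂ u)
    (hg : Differentiable ℂ g) (hg0 : ∃ x, g x ≠ 0) (h : ∀ x, u x * g x = 0) : u = 0 := by
  obtain ⟨c, hc⟩ := hg0
  have han : AnalyticOnNhd ℂ u univ := (differentiableOn_univ.2 hu).analyticOnNhd isOpen_univ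
  have : u =ᶠ[𝓝 c] 0 := by
    filter_upwards [hg.continuous.continuousAt.eventually_ne hc] with y hy
    exact (mul_eq_zero.1 (h y)).resolve_right hy
  exact han.eq_of_eventuallyEq analyticOnNhd_const this

section
variable {T : ℂ} (hT : 0 < T.im)
include hT

/-- The addition formula for `J`, with denominators cleared. -/
theorem theta_addition (x : ℂ) {y z : ℂ} (hy : theta T y ≠ 0) (hz : theta T z ≠ 0)
    (hyz : theta T (y - z) ≠ 0) :
    (thetaNum T x * theta T (x + (y + z)) + theta T x * ((zetaQ T y + zetaQ T z) *
      theta T (x + (y + z)) - thetaNum T (x + (y + z)))) * (theta T y * theta T z) =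
    qPoch (expo T) (expo T) ^ 2 * theta T (y + z) * (theta T (x + y) * theta T (x + z)) := by
  set c := y + z with hc
  set J := zetaQ T y + zetaQ T z with hJ
  -- Where nothing vanishes, f is θ(x) θ(x + c) (J(x) + J(y) + J(z) - J(x + c)). Both f and g pick
  -- up the same factors under x + 1 and x + T, and f vanishes at the zeros of g, which are simple
  -- because y - z is not a lattice point. So f/g is entire and doubly periodic, hence constant,
  -- with its value read off at 0.
  let f : ℂ → ℂ := fun x => thetaNum T x * theta T (x + c) +
    theta T x * (J * theta T (x + c) - thetaNum T (x + c))
  let g : ℂ → ℂ := fun x => theta T (x + y) * theta T (x + z)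
  have ht := differentiable_theta hT
  have hn := differentiable_thetaNum hT
  have hts : ∀ a, Differentiable ℂ fun x => theta T (x + a) := fun a =>
    ht.comp (differentiable_id.add_const a)
  have hns : ∀ a, Differentiable ℂ fun x => thetaNum T (x + a) := fun a =>
    hn.comp (differentiable_id.add_const a)
  have hf : Differentiable ℂ f :=
    (hn.mul (hts c)).add (ht.mul (((hts c).const_mul J).sub (hns c)))
  have hg : Differentiable ℂ g := (hts y).mul (hts z)
  have f1 : ∀ x, f (x + 1) = f x := fun x => by
    simp only [f]
    rw [add_right_comm, theta_add_one, theta_add_one, thetaNum_add_one, thetaNum_add_one]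
  have g1 : ∀ x, g (x + 1) = g x := fun x => by
    simp only [g]
    rw [add_right_comm, theta_add_one, add_right_comm, theta_add_one]
  have f2 : ∀ x, f (x + T) = expo (-x) * expo (-(x + c)) * f x := fun x => by
    simp only [f]
    rw [add_right_comm, theta_add_period hT, theta_add_period hT, thetaNum_add_period hT,
      thetaNum_add_period hT]
    ring
  have g2 : ∀ x, g (x + T) = expo (-x) * expo (-(x + c)) * g x := fun x => by
    simp only [g]
    rw [add_right_comm, theta_add_period hT, add_right_comm, theta_add_period hT, ← expo_add,
      show -x + -(x + c) = -(x + y) + -(x + z) by rw [hc]; ring, expo_add]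
    ring
  have negz : ∀ {a}, theta T a ≠ 0 → theta T (-a) ≠ 0 := fun h => by
    rw [theta_neg hT]
    exact mul_ne_zero (neg_ne_zero.2 (expo_ne_zero _)) h
  -- For x = -y + mT + n one has J(x) = -J(y) + m and J(x + y + z) = J(z) + m, so the four values of
  -- J cancel.
  have vanish : ∀ x y z, theta T y ≠ 0 → theta T z ≠ 0 → theta T (x + y) = 0 →
      thetaNum T x * theta T (x + (y + z)) + theta T x * ((zetaQ T y + zetaQ T z) *
      theta T (x + (y + z)) - thetaNum T (x + (y + z))) = 0 := by
    intro x y z hy hz h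
    obtain ⟨m, n, hmn⟩ := (theta_eq_zero_iff hT _).1 h
    have hx : x = (-y + m * T) + n := by linear_combination hmn
    have hxz : x + (y + z) = (z + m * T) + n := by rw [hx]; ring
    have num : ∀ a, theta T a ≠ 0 → thetaNum T (a + m * T + n) =
        (zetaQ T a + m) * theta T (a + m * T + n) := by
      intro a ha
      have h0 : theta T (a + m * T + n) ≠ 0 := by
        rw [add_assoc, Ne, theta_add_lattice_eq_zero_iff hT]
        exact ha
      rw [← zetaQ_add_int_mul_period hT ha, ← zetaQ_add_int _ n, zetaQ, div_mul_cancel₀ _ h0]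
    rw [hxz, hx, num _ (negz hy), num _ hz, zetaQ_neg hT]
    ring
  have simple : ∀ x, g x = 0 → f x = 0 ∧ deriv g x ≠ 0 := by
    intro x hx
    have hd : deriv g x = deriv (theta T) (x + y) * theta T (x + z) +
        theta T (x + y) * deriv (theta T) (x + z) := by
      have h1 : HasDerivAt (fun x => theta T (x + y)) (deriv (theta T) (x + y)) x :=
        ((ht _).hasDerivAt).comp_add_const x y
      have h2 : HasDerivAt (fun x => theta T (x + z)) (deriv (theta T) (x + z)) x :=
        ((ht _).hasDerivAt).comp_add_const x z
      exact (h1.fun_mul h2).deriv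
    have key : ∀ y z, theta T (y - z) ≠ 0 → theta T (x + y) = 0 → theta T (x + z) ≠ 0 := by
      intro y z hyz h h'
      apply hyz
      obtain ⟨m, n, hmn⟩ := (theta_eq_zero_iff hT _).1 h
      obtain ⟨m', n', hmn'⟩ := (theta_eq_zero_iff hT _).1 h'
      refine (theta_eq_zero_iff hT _).2 ⟨m - m', n - n', ?_⟩
      push_cast
      linear_combination hmn - hmn'
    rcases mul_eq_zero.1 hx with h | h
    · refine ⟨vanish x y z hy hz h, ?_⟩
      rw [hd, h, zero_mul, add_zero]
      exact mul_ne_zero (deriv_theta_ne_zero hT h) (key y z hyz h)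
    · have hzy : theta T (z - y) ≠ 0 := by rw [← neg_sub]; exact negz hyz
      refine ⟨?_, ?_⟩
      · have := vanish x z y hz hy h
        rwa [add_comm z y, add_comm (zetaQ T z)] at this
      · rw [hd, h, mul_zero, zero_add]
        exact mul_ne_zero (key z y hzy h) (deriv_theta_ne_zero hT h)
  obtain ⟨u, hu, huf⟩ := exists_differentiable_eq_mul hf hg simple
  have hg0 : g 0 = theta T y * theta T z := by simp [g]
  have hgne : ∃ x, g x ≠ 0 := ⟨0, by rw [hg0]; exact mul_ne_zero hy hz⟩
  have per : ∀ t, Differentiable ℂ fun x => u (x + t) - u x := fun t =>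
    (hu.comp (differentiable_id.add_const t)).sub hu
  have u1 : Function.Periodic u 1 := fun x => by
    have := Differentiable.eq_zero_of_mul_eq_zero (per 1) hg hgne fun x => by
      have := huf (x + 1)
      rw [f1, g1, huf] at this
      linear_combination -this
    exact sub_eq_zero.1 (congrFun this x)
  have u2 : Function.Periodic u T := fun x => by
    have := Differentiable.eq_zero_of_mul_eq_zero (per T) hg hgne fun x => by
      have := huf (x + T)
      rw [f2, g2, huf] at this
      have h0 : expo (-x) * expo (-(x + c)) ≠ 0 := mul_ne_zero (expo_ne_zero _) (expo_ne_zero _)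
      refine mul_left_cancel₀ h0 ?_
      linear_combination -this
    exact sub_eq_zero.1 (congrFun this x)
  have hconst := eq_of_differentiable_of_periodic hT hu u1 u2 x 0
  have hf0 : f 0 = qPoch (expo T) (expo T) ^ 2 * theta T c := by
    simp only [f]
    rw [theta_zero hT, thetaNum_zero hT, zero_add]
    ring
  have h0 := huf 0
  rw [hf0, hg0] at h0
  change f x * (theta T y * theta T z) = _ * g x
  rw [h0, huf x, hconst]
  ring

/-- For `x₁ + x₂ + x₃ + x₄ = 0` the sum of the `J(xᵢ)` is a quotient of theta functions. -/
theorem zetaQ_sum_eq {x y z : ℂ} (hx : theta T x ≠ 0) (hy : theta T y ≠ 0) (hz : theta T z ≠ 0)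
    (hxyz : theta T (x + (y + z)) ≠ 0) (hyz : theta T (y - z) ≠ 0) :
    zetaQ T x + zetaQ T y + zetaQ T z - zetaQ T (x + (y + z)) =
      qPoch (expo T) (expo T) ^ 2 * (theta T (y + z) * theta T (x + y) * theta T (x + z)) /
        (theta T x * theta T y * theta T z * theta T (x + (y + z))) := by
  have h := theta_addition hT x hy hz hyz
  rw [eq_div_iff (by simp [hx, hy, hz, hxyz])]
  have e1 : thetaNum T x = zetaQ T x * theta T x := by rw [zetaQ, div_mul_cancel₀ _ hx]
  have e2 : thetaNum T (x + (y + z)) = zetaQ T (x + (y + z)) * theta T (x + (y + z)) := by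
    rw [zetaQ, div_mul_cancel₀ _ hxyz]
  rw [e1, e2] at h
  linear_combination h

end
end PCore

end

/-! ### Sums of values of J as lattice sums -/

noncomputable section
namespace PCore
open Complex Filter Topology Set Asymptotics

theorem tsum_int_eq_zero_add_tsum_nat {f : ℤ → ℂ} (hf : Summable f) :
    ∑' n : ℤ, f n = f 0 + ∑' k : ℕ, (f (k + 1) + f (-(k + 1))) := by
  have h1 : Summable fun k : ℕ => f (k + 1) :=
    hf.comp_injective (i := fun k : ℕ => ((k : ℤ) + 1)) fun a b h => by simpa using h
  have h2 : Summable fun k : ℕ => f (-(k + 1)) :=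
    hf.comp_injective (i := fun k : ℕ => (-((k : ℤ) + 1))) fun a b h => by simpa using h
  rw [tsum_of_add_one_of_neg_add_one h1 h2, h1.tsum_add h2]
  ring

theorem summable_inv_linear_mul_inv_linear (u v : ℂ) :
    Summable fun n : ℤ => ((u - n) * (v + n))⁻¹ := by
  apply EisensteinSeries.summable_inv_of_isBigO_rpow_inv (a := 2) (by norm_num)
  have h1 := EisensteinSeries.linear_inv_isBigO_right 1 v
  have h2 := (EisensteinSeries.linear_inv_isBigO_right 1 u).comp_neg_int
  simpa [pow_two, mul_comm, ← sub_eq_add_neg] using h1.mul h2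

/-- The sum of `1 / (u - n) + 1 / (v + n)` over all integers `n`, by the partial fraction
expansion of the cotangent. -/
theorem tsum_inv_sub_add_inv_add {u v : ℂ} (hu : u ∈ integerComplement)
    (hv : v ∈ integerComplement) :
    ∑' n : ℤ, (1 / (u - n) + 1 / (v + n)) =
      Real.pi * cot (Real.pi * u) + Real.pi * cot (Real.pi * v) := by
  have hu0 : ∀ n : ℤ, u - n ≠ 0 := fun n => by
    simpa [sub_eq_add_neg] using integerComplement_add_ne_zero hu (-n)
  have hv0 : ∀ n : ℤ, v + n ≠ 0 := integerComplement_add_ne_zero hv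
  -- Neither half is summable alone; combined they give (u + v) / ((u - n)(v + n)).
  have hs : Summable fun n : ℤ => (1 / (u - n) + 1 / (v + n)) := by
    refine ((summable_inv_linear_mul_inv_linear u v).mul_left (u + v)).congr fun n => ?_
    have := hu0 n
    have := hv0 n
    field_simp
    ring
  have cu := cot_series_rep' hu
  have cv := cot_series_rep' hv
  have su : Summable fun n : ℕ => (1 / (u - (n + 1)) + 1 / (u + (n + 1))) := summable_cotTerm hu
  have sv : Summable fun n : ℕ => (1 / (v - (n + 1)) + 1 / (v + (n + 1))) := summable_cotTerm hv
  rw [sub_eq_iff_eq_add] at cu cv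
  rw [tsum_int_eq_zero_add_tsum_nat hs, cu, cv]
  rw [show ∀ a b c d : ℂ, a + b + (c + d) = (b + d) + (a + c) by intros; ring, ← su.tsum_add sv]
  congr 1
  · simp
  · refine tsum_congr fun k => ?_
    push_cast
    ring_nf

/-- The lattice summand `∑ᵢ xᵢ / (xᵢ² - ω²)`. -/
def latticeTerm {ι : Type*} [Fintype ι] (x : ι → ℂ) (ω : ℂ) : ℂ :=
  ∑ i, x i / (x i ^ 2 - ω ^ 2)

/-- The function is x/(x² - ω²) + x/ω² at ω = v₀τ + v₁. The constant 4/3 comes from |x² - ω²| ≥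
(3/4)|ω|², valid once |ω| ≥ 2|x|. -/
theorem isBigO_inv_pow_four (τ : UpperHalfPlane) (x : ℂ) :
    (fun v : Fin 2 → ℤ => x ^ 3 / ((v 0 * (τ : ℂ) + v 1) ^ 2 *
      (x ^ 2 - (v 0 * (τ : ℂ) + v 1) ^ 2))) =O[cofinite] fun v => (‖v‖ ^ (4 : ℝ))⁻¹ := by
  have hr := EisensteinSeries.r_pos τ
  set r := EisensteinSeries.r τ with hrdef
  apply IsBigO.of_bound (‖x‖ ^ 3 * (4 / 3) / r ^ 4)
  have hlim : Tendsto (fun v : Fin 2 → ℤ => ‖v‖) cofinite atTop := by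
    have := tendsto_norm_cocompact_atTop (E := Fin 2 → ℤ)
    rwa [cocompact_eq_cofinite] at this
  filter_upwards [hlim.eventually_ge_atTop (2 * ‖x‖ / r), hlim.eventually_gt_atTop 0] with v hv hv0
  have hvne : v ≠ 0 := norm_pos_iff.1 hv0
  have hb : r * ‖v‖ ≤ ‖(v 0 : ℂ) * τ + v 1‖ := EisensteinSeries.r_mul_max_le τ hvne
  set ω := (v 0 : ℂ) * τ + v 1 with hω
  have hx2 : 2 * ‖x‖ ≤ ‖ω‖ := by
    rw [div_le_iff₀ hr] at hv
    linarith
  have hω0 : 0 < ‖ω‖ := lt_of_lt_of_le (mul_pos hr hv0) hb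
  have h1 : 3 / 4 * ‖ω‖ ^ 2 ≤ ‖x ^ 2 - ω ^ 2‖ := by
    have := norm_sub_norm_le (ω ^ 2) (x ^ 2)
    rw [norm_sub_rev, norm_pow, norm_pow] at this
    nlinarith [norm_nonneg x]
  have h2 : (r * ‖v‖) ^ 4 ≤ ‖ω‖ ^ 4 := by gcongr
  rw [norm_div, norm_mul, norm_pow, norm_pow, norm_inv, Real.norm_of_nonneg (by positivity),
    show ‖v‖ ^ (4 : ℝ) = ‖v‖ ^ 4 by rw [← Real.rpow_natCast]; norm_num]
  calc ‖x‖ ^ 3 / (‖ω‖ ^ 2 * ‖x ^ 2 - ω ^ 2‖) ≤ ‖x‖ ^ 3 / (‖ω‖ ^ 2 * (3 / 4 * ‖ω‖ ^ 2)) := by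
        gcongr
    _ = ‖x‖ ^ 3 * (4 / 3) / ‖ω‖ ^ 4 := by field_simp
    _ ≤ ‖x‖ ^ 3 * (4 / 3) / (r * ‖v‖) ^ 4 := by
        gcongr
    _ = _ := by field_simp

variable {ι : Type*} [Fintype ι]

/-- A single x/(x² - ω²) decays only like |ω|⁻², which is not enough on a lattice. Since ∑ xᵢ = 0,
the terms xᵢ/ω² can be added for free, and the decay becomes |ω|⁻⁴. -/
theorem summable_latticeTerm (τ : UpperHalfPlane) {x : ι → ℂ} (hx : ∑ i, x i = 0)
    (hne : ∀ i, ∀ m n : ℤ, x i ≠ m * τ + n) :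
    Summable fun v : ℤ × ℤ => latticeTerm x (v.1 * τ + v.2) := by
  rw [← (finTwoArrowEquiv ℤ).summable_iff]
  have hs : Summable fun v : Fin 2 → ℤ => ∑ i, x i ^ 3 / ((v 0 * (τ : ℂ) + v 1) ^ 2 *
      (x i ^ 2 - (v 0 * (τ : ℂ) + v 1) ^ 2)) :=
    summable_sum fun i _ => EisensteinSeries.summable_of_isBigO_rpow_norm (by norm_num)
      (isBigO_inv_pow_four τ (x i))
  refine hs.congr_cofinite ?_
  have : ∀ᶠ v : Fin 2 → ℤ in cofinite, v ≠ 0 := by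
    simp
  filter_upwards [this] with v hv
  have hb := EisensteinSeries.r_mul_max_le τ hv
  have hω : (v 0 : ℂ) * τ + v 1 ≠ 0 := by
    rw [← norm_pos_iff]
    exact lt_of_lt_of_le (mul_pos (EisensteinSeries.r_pos τ) (norm_pos_iff.2 hv)) hb
  change _ = ∑ i, x i / (x i ^ 2 - ((v 0 : ℂ) * τ + v 1) ^ 2)
  set ω := (v 0 : ℂ) * τ + v 1 with hωdef
  have h0 : ∑ i, x i / (x i ^ 2 - ω ^ 2) = ∑ i, x i / (x i ^ 2 - ω ^ 2) + (∑ i, x i) / ω ^ 2 := by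
    rw [hx]; simp
  rw [h0, Finset.sum_div, ← Finset.sum_add_distrib]
  refine Finset.sum_congr rfl fun i _ => ?_
  have h1 : x i ^ 2 - ω ^ 2 ≠ 0 := by
    rw [sq_sub_sq]
    refine mul_ne_zero (fun h => hne i (-v 0) (-v 1) ?_) (fun h => hne i (v 0) (v 1) ?_)
    · push_cast; linear_combination h
    · linear_combination h
  field_simp
  ring

theorem pi_mul_cot_pi {x : ℂ} (hx : expo x ≠ 1) : Real.pi * cot (Real.pi * x) =
    -(2 * Real.pi * I) * (1 / 2 + expo x / (1 - expo x)) := by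
  rw [Complex.cot_pi_eq_exp_ratio]
  have h : 1 - expo x ≠ 0 := sub_ne_zero.2 hx.symm
  change _ * ((expo x + 1) / (I * (1 - expo x))) = _
  field_simp
  rw [I_sq]
  ring

theorem expo_ne_one_of_ne_lattice {T x : ℂ} (hx : ∀ m n : ℤ, x ≠ m * T + n) (m : ℤ) :
    expo (x + m * T) ≠ 1 := by
  rw [Ne, expo_eq_one_iff]
  rintro ⟨n, hn⟩
  exact hx (-m) n (by push_cast; linear_combination hn)

/-- The rows k + 1 and -(k + 1) together give the summands of the two Lambert series of J. With w =
e(T - x + kT), the identity w⁻¹/(1 - w⁻¹) = -1 - w/(1 - w) cancels the two constants 1/2. -/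
theorem pi_mul_cot_sum (T : ℂ) {x : ℂ} (hx : ∀ m n : ℤ, x ≠ m * T + n) (k : ℕ) :
    Real.pi * cot (Real.pi * (x - ((k : ℂ) + 1) * T)) + Real.pi * cot (Real.pi * (x + (k + 1) * T)) =
    -(2 * Real.pi * I) * (expo x * expo T ^ (k + 1) / (1 - expo x * expo T ^ (k + 1)) -
      expo T * expo (-x) * expo T ^ k / (1 - expo T * expo (-x) * expo T ^ k)) := by
  have e1 : expo (x + (k + 1) * T) = expo x * expo T ^ (k + 1) := by
    rw [expo_add, ← expo_nat_mul]; push_cast; rfl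
  have e2 : expo (x - (k + 1) * T) = (expo T * expo (-x) * expo T ^ k)⁻¹ := by
    rw [sub_eq_add_neg, expo_add, expo_neg, expo_neg]
    rw [show expo ((k + 1) * T) = expo T ^ (k + 1) by rw [← expo_nat_mul]; push_cast; rfl]
    have := expo_ne_zero x
    have := expo_ne_zero T
    field_simp
    ring
  have n1 : expo (x + (k + 1) * T) ≠ 1 := by
    simpa using expo_ne_one_of_ne_lattice hx (k + 1)
  have n2 : expo (x - (k + 1) * T) ≠ 1 := by
    convert expo_ne_one_of_ne_lattice hx (-(k + 1)) using 2
    push_cast; ring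
  rw [pi_mul_cot_pi n1, pi_mul_cot_pi n2, e1, e2]
  rw [e2] at n2
  rw [e1] at n1
  have hw : expo T * expo (-x) * expo T ^ k ≠ 0 :=
    mul_ne_zero (mul_ne_zero (expo_ne_zero _) (expo_ne_zero _)) (pow_ne_zero _ (expo_ne_zero _))
  generalize expo T * expo (-x) * expo T ^ k = w at *
  generalize expo x * expo T ^ (k + 1) = w' at *
  have h1 : w ≠ 1 := fun h => n2 (by rw [h, inv_one])
  have h2 : w - 1 ≠ 0 := sub_ne_zero.2 h1
  have h3 : 1 - w ≠ 0 := sub_ne_zero.2 h1.symm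
  have h4 : 1 - w' ≠ 0 := sub_ne_zero.2 n1.symm
  have h5 : w⁻¹ / (1 - w⁻¹) = -(1 / (1 - w)) := by
    rw [show 1 - w⁻¹ = -(1 - w) / w by field_simp; ring]
    field_simp
  rw [h5]
  field_simp
  ring

/-- The sum of the `J(xᵢ)` over a family with `∑ xᵢ = 0` is an absolutely convergent sum over
the lattice `ℤ + ℤτ`. -/
theorem tsum_latticeTerm (τ : UpperHalfPlane) {x : ι → ℂ} (hx : ∑ i, x i = 0)
    (hne : ∀ i, ∀ m n : ℤ, x i ≠ m * τ + n) :
    ∑' v : ℤ × ℤ, latticeTerm x (v.1 * τ + v.2) = -(2 * Real.pi * I) * ∑ i, zetaQ τ (x i) := by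
  have hs := summable_latticeTerm τ hx hne
  have hT : 0 < (τ : ℂ).im := τ.im_pos
  -- The sum over the row m of the lattice. It is even in m, so two opposite rows make up for the
  -- factor 1/2, which comes from the partial fractions of x/(x² - ω²).
  let c : ℤ → ℂ := fun m => ∑ i, (1 / 2 : ℂ) * (Real.pi * cot (Real.pi * (x i - m * τ)) +
    Real.pi * cot (Real.pi * (x i + m * τ)))
  have inner : ∀ m : ℤ, ∑' n : ℤ, latticeTerm x (m * τ + n) = c m := by
    intro m
    have hmem : ∀ i, ∀ m : ℤ, x i + m * τ ∈ integerComplement := by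
      rintro i m ⟨n, hn⟩
      exact hne i (-m) n (by push_cast; linear_combination -hn)
    have hmem' : ∀ i, x i - m * τ ∈ integerComplement := fun i => by
      have := hmem i (-m)
      rwa [Int.cast_neg, neg_mul, ← sub_eq_add_neg] at this
    have hterm : ∀ i (n : ℤ), x i / (x i ^ 2 - (m * (τ : ℂ) + n) ^ 2) = (1 / 2 : ℂ) *
        (1 / (x i - m * τ - n) + 1 / (x i + m * τ + n)) := by
      intro i n
      have h1 : x i - m * τ - n ≠ 0 := fun h => hne i m n (by linear_combination h)
      have h2 : x i + m * τ + n ≠ 0 := fun h => hne i (-m) (-n) (by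
        push_cast; linear_combination h)
      rw [show x i ^ 2 - (m * (τ : ℂ) + n) ^ 2 = (x i - m * τ - n) * (x i + m * τ + n) by ring]
      field_simp
      ring
    simp only [latticeTerm]
    rw [Summable.tsum_finsetSum]
    · refine Finset.sum_congr rfl fun i _ => ?_
      simp only [hterm]
      rw [tsum_mul_left, tsum_inv_sub_add_inv_add (hmem' i) (hmem i m)]
    · intro i _
      refine ((summable_inv_linear_mul_inv_linear (x i - m * τ) (x i + m * τ)).mul_left
        (x i)).congr fun n => ?_
      rw [show x i ^ 2 - (m * (τ : ℂ) + n) ^ 2 = (x i - m * τ - n) * (x i + m * τ + n) by ring,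
        div_eq_mul_inv]
  have hc : Summable c := by
    have := hs.prod
    simpa only [inner] using this
  rw [hs.tsum_prod]
  simp only [inner]
  rw [tsum_int_eq_zero_add_tsum_nat hc]
  have hq := norm_expo_lt_one hT
  have s1 : ∀ i, Summable fun k : ℕ => expo (x i) * expo τ ^ k / (1 - expo (x i) * expo τ ^ k) :=
    fun i => summable_div_one_sub hq _
  have s1' : ∀ i, Summable fun k : ℕ =>
      expo (x i) * expo τ ^ (k + 1) / (1 - expo (x i) * expo τ ^ (k + 1)) :=
    fun i => (summable_nat_add_iff 1).2 (s1 i)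
  have s2 : ∀ i, Summable fun k : ℕ =>
      expo τ * expo (-x i) * expo τ ^ k / (1 - expo τ * expo (-x i) * expo τ ^ k) :=
    fun i => summable_div_one_sub hq _
  have hck : ∀ k : ℕ, c (k + 1) + c (-(k + 1)) = ∑ i, -(2 * Real.pi * I) *
      (expo (x i) * expo τ ^ (k + 1) / (1 - expo (x i) * expo τ ^ (k + 1)) -
      expo τ * expo (-x i) * expo τ ^ k / (1 - expo τ * expo (-x i) * expo τ ^ k)) := by
    intro k
    simp only [c, ← Finset.sum_add_distrib]
    refine Finset.sum_congr rfl fun i _ => ?_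
    rw [← pi_mul_cot_sum τ (hne i) k]
    push_cast
    rw [neg_mul, sub_neg_eq_add, ← sub_eq_add_neg]
    ring
  simp only [hck]
  rw [Summable.tsum_finsetSum fun i _ => ((s1' i).sub (s2 i)).mul_left _, ← Finset.sum_add_distrib,
    Finset.mul_sum]
  refine Finset.sum_congr rfl fun i _ => ?_
  have hxi : expo (x i) ≠ 1 := by simpa using expo_ne_one_of_ne_lattice (hne i) 0
  rw [tsum_mul_left, (s1' i).tsum_sub (s2 i), zetaQ_eq_tsum hT (theta_ne_zero hT (hne i)),
    (s1 i).tsum_eq_zero_add]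
  simp only [Int.cast_zero, zero_mul, sub_zero, add_zero, pi_mul_cot_pi hxi, pow_zero, mul_one]
  ring

end PCore

end

/-! ### The value L(0, χ) for odd characters -/

noncomputable section
namespace PCore
open Complex Filter Topology Set

theorem sum_mul_eq_abel (b u : ℕ → ℝ) (N : ℕ) : ∑ k ∈ Finset.range N, b k * u k =
    (∑ k ∈ Finset.range N, b k) * u N +
      ∑ k ∈ Finset.range N, (∑ j ∈ Finset.range (k + 1), b j) * (u k - u (k + 1)) := by
  induction N with
  | zero => simp
  | succ N ih =>
    rw [Finset.sum_range_succ, ih, Finset.sum_range_succ _ N, Finset.sum_range_succ _ N,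
      Finset.sum_range_succ b N]
    ring

theorem inv_rpow_sub_nonneg (k : ℕ) {s : ℝ} (hs : 0 ≤ s) :
    0 ≤ ((k : ℝ) + 1) ^ (-s) - ((k : ℝ) + 1 + 1) ^ (-s) := by
  rw [sub_nonneg]
  exact Real.rpow_le_rpow_of_nonpos (by positivity) (by linarith) (by linarith)

/-- With t = (k + 1)/(k + 2), one has 1 - t^s ≤ 1 - t² ≤ 2(1 - t). The bound does not depend on s,
so it can serve as a majorant for s → 1⁺. -/
theorem inv_rpow_sub_le (k : ℕ) {s : ℝ} (hs : 1 ≤ s) (hs2 : s ≤ 2) :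
    ((k : ℝ) + 1) ^ (-s) - ((k : ℝ) + 1 + 1) ^ (-s) ≤ 2 * (1 / ((k : ℝ) + 1) ^ 2) := by
  have h1 : (0 : ℝ) < (k : ℝ) + 1 := by positivity
  have h2 : (0 : ℝ) < (k : ℝ) + 1 + 1 := by positivity
  set t : ℝ := ((k : ℝ) + 1) / ((k : ℝ) + 1 + 1) with ht
  have ht0 : 0 < t := by positivity
  have ht1 : t ≤ 1 := by rw [ht, div_le_one h2]; linarith
  have e : ((k : ℝ) + 1 + 1) ^ (-s) = ((k : ℝ) + 1) ^ (-s) * t ^ s := by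
    rw [ht, Real.div_rpow h1.le h2.le, Real.rpow_neg h1.le, Real.rpow_neg h2.le]
    have := (Real.rpow_pos_of_pos h1 s).ne'
    have := (Real.rpow_pos_of_pos h2 s).ne'
    field_simp
  have h3 : t ^ (2 : ℝ) ≤ t ^ s := Real.rpow_le_rpow_of_exponent_ge ht0 ht1 hs2
  have h4 : ((k : ℝ) + 1) ^ (-s) ≤ ((k : ℝ) + 1) ^ (-1 : ℝ) :=
    Real.rpow_le_rpow_of_exponent_le (by linarith) (by linarith)
  have h5 : 1 - t = 1 / ((k : ℝ) + 1 + 1) := by rw [ht]; field_simp; ring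
  rw [Real.rpow_neg_one] at h4
  rw [Real.rpow_two] at h3
  have h6 : 0 < ((k : ℝ) + 1) ^ (-s) := Real.rpow_pos_of_pos h1 _
  calc ((k : ℝ) + 1) ^ (-s) - ((k : ℝ) + 1 + 1) ^ (-s) = ((k : ℝ) + 1) ^ (-s) * (1 - t ^ s) := by
        rw [e]; ring
    _ ≤ ((k : ℝ) + 1) ^ (-s) * (2 * (1 - t)) := by
        gcongr
        nlinarith
    _ ≤ ((k : ℝ) + 1)⁻¹ * (2 * (1 / ((k : ℝ) + 1))) := by
        rw [h5]
        gcongr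
        linarith
    _ = _ := by field_simp

/-- A Dirichlet series with bounded coefficient sums converges at `1` to its limit at `1⁺`. -/
theorem tendsto_sum_div_of_bounded {b : ℕ → ℝ} {C : ℝ}
    (hb : ∀ N, |∑ k ∈ Finset.range N, b k| ≤ C) {F : ℝ → ℝ} (hF : ContinuousAt F 1)
    (hFb : ∀ s, 1 < s → HasSum (fun k : ℕ => b k * ((k : ℝ) + 1) ^ (-s)) (F s)) :
    Tendsto (fun N => ∑ k ∈ Finset.range N, b k / ((k : ℝ) + 1)) atTop (𝓝 (F 1)) := by
  set S : ℕ → ℝ := fun N => ∑ k ∈ Finset.range N, b k with hS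
  have hC : 0 ≤ C := (abs_nonneg _).trans (hb 0)
  let g : ℝ → ℕ → ℝ := fun s k => S (k + 1) * (((k : ℝ) + 1) ^ (-s) - ((k : ℝ) + 1 + 1) ^ (-s))
  have hbound : Summable fun k : ℕ => C * (2 * (1 / ((k : ℝ) + 1) ^ 2)) := by
    have := (summable_nat_add_iff 1).2 (Real.summable_one_div_nat_pow.2 (one_lt_two))
    push_cast at this
    exact (this.mul_left 2).mul_left C
  have hg : ∀ s, 1 ≤ s → s ≤ 2 → ∀ k, ‖g s k‖ ≤ C * (2 * (1 / ((k : ℝ) + 1) ^ 2)) := by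
    intro s h1 h2 k
    rw [norm_mul, Real.norm_eq_abs, Real.norm_of_nonneg (inv_rpow_sub_nonneg k (by linarith))]
    exact mul_le_mul (hb _) (inv_rpow_sub_le k h1 h2) (inv_rpow_sub_nonneg k (by linarith)) hC
  -- After Abel summation the series converges absolutely, also at s = 1, where the original one
  -- need not.
  have hpart : ∀ s, 1 ≤ s → s ≤ 2 → Tendsto (fun N => ∑ k ∈ Finset.range N,
      b k * ((k : ℝ) + 1) ^ (-s)) atTop (𝓝 (∑' k, g s k)) := by
    intro s h1 h2
    have hs : Summable (g s) := Summable.of_norm_bounded hbound (hg s h1 h2)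
    have h0 : Tendsto (fun N : ℕ => S N * ((N : ℝ) + 1) ^ (-s)) atTop (𝓝 0) := by
      have h3 : Tendsto (fun N : ℕ => ((N : ℝ) + 1) ^ (-s)) atTop (𝓝 0) :=
        (tendsto_rpow_neg_atTop (by linarith)).comp
          (tendsto_atTop_add_const_right _ 1 tendsto_natCast_atTop_atTop)
      refine squeeze_zero_norm (fun N => ?_) (by simpa using h3.const_mul C)
      rw [norm_mul, Real.norm_eq_abs, Real.norm_of_nonneg (by positivity)]
      exact mul_le_mul_of_nonneg_right (hb N) (by positivity)
    have := h0.add hs.hasSum.tendsto_sum_nat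
    rw [zero_add] at this
    refine this.congr fun N => ?_
    rw [sum_mul_eq_abel b (fun k => ((k : ℝ) + 1) ^ (-s))]
    push_cast
    rfl
  have hFg : ∀ s, 1 < s → s ≤ 2 → ∑' k, g s k = F s := fun s h1 h2 =>
    tendsto_nhds_unique (hpart s h1.le h2) (hFb s h1).tendsto_sum_nat
  have hlim : Tendsto (fun s => ∑' k, g s k) (𝓝[>] 1) (𝓝 (∑' k, g 1 k)) := by
    refine tendsto_tsum_of_dominated_convergence hbound (fun k => ?_) ?_
    · have : ContinuousAt (fun s => g s k) 1 := by
        have h1 : (0 : ℝ) < (k : ℝ) + 1 := by positivity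
        have h2 : (0 : ℝ) < (k : ℝ) + 1 + 1 := by positivity
        simp only [g]
        refine continuousAt_const.mul (ContinuousAt.sub ?_ ?_)
        · exact continuousAt_const.rpow continuousAt_id.neg (Or.inl h1.ne')
        · exact continuousAt_const.rpow continuousAt_id.neg (Or.inl h2.ne')
      exact this.tendsto.mono_left nhdsWithin_le_nhds
    · filter_upwards [Ioc_mem_nhdsGT (show (1 : ℝ) < 2 by norm_num)] with s hs k
      exact hg s hs.1.le hs.2 k
  have hlim2 : Tendsto (fun s => ∑' k, g s k) (𝓝[>] 1) (𝓝 (F 1)) := by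
    refine (hF.tendsto.mono_left nhdsWithin_le_nhds).congr' ?_
    filter_upwards [Ioc_mem_nhdsGT (show (1 : ℝ) < 2 by norm_num)] with s hs
    exact (hFg s hs.1 hs.2).symm
  have h1 := hpart 1 le_rfl one_le_two
  rw [tendsto_nhds_unique hlim hlim2] at h1
  refine h1.congr fun N => Finset.sum_congr rfl fun k _ => ?_
  rw [Real.rpow_neg_one, div_eq_mul_inv]

/-- Polar form: 1 - e(a) = 2 sin(πa) exp(i(πa - π/2)) with sin(πa) > 0. -/
theorem arg_one_sub_expo {a : ℝ} (ha : 0 < a) (ha1 : a < 1) :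
    (1 - expo a).arg = Real.pi * a - Real.pi / 2 := by
  have hsin : 0 < Real.sin (Real.pi * a) := Real.sin_pos_of_pos_of_lt_pi
    (by positivity) (by nlinarith [Real.pi_pos])
  have h : 1 - expo a = ((2 * Real.sin (Real.pi * a) : ℝ) : ℂ) *
      (cos ((Real.pi * a - Real.pi / 2 : ℝ) : ℂ) + sin ((Real.pi * a - Real.pi / 2 : ℝ) : ℂ) * I) := by
    rw [expo, show (2 * Real.pi * I * (a : ℂ)) = ((2 * (Real.pi * a) : ℝ) : ℂ) * I by
      push_cast; ring, exp_mul_I, ← ofReal_cos, ← ofReal_sin, ← ofReal_cos, ← ofReal_sin,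
      Real.cos_sub_pi_div_two, Real.sin_sub_pi_div_two, Real.cos_two_mul, Real.sin_two_mul]
    have := Real.sin_sq_add_cos_sq (Real.pi * a)
    apply Complex.ext
    · simp [-ofReal_sin, -ofReal_cos, -ofReal_mul]
      nlinarith
    · simp [-ofReal_sin, -ofReal_cos, -ofReal_mul]
  rw [h, Complex.arg_mul_cos_add_sin_mul_I (by linarith)]
  constructor <;> nlinarith [Real.pi_pos]

/-- The imaginary part of the Taylor series of -log(1 - e(a)x). -/
theorem hasSum_sin_mul_pow_div {a x : ℝ} (hx0 : 0 ≤ x) (hx : x < 1) :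
    HasSum (fun k : ℕ => Real.sin (2 * Real.pi * a * (k + 1)) / (k + 1) * x ^ k * x)
      (-(1 - expo a * x).arg) := by
  have hn : ‖expo a * x‖ < 1 := by
    rw [norm_mul, expo, show (2 * Real.pi * I * (a : ℂ)) = ((2 * Real.pi * a : ℝ) : ℂ) * I by
      push_cast; ring, norm_exp_ofReal_mul_I, one_mul, norm_real, Real.norm_of_nonneg hx0]
    exact hx
  have h := Complex.hasSum_im (hasSum_taylorSeries_neg_log' hn)
  rw [neg_im, log_im] at h
  refine h.congr_fun fun k => ?_
  rw [mul_pow, ← expo_nat_mul, expo, show (2 * Real.pi * I * (((k + 1 : ℕ) : ℂ) * (a : ℂ))) =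
    ((2 * Real.pi * a * (k + 1) : ℝ) : ℂ) * I by push_cast; ring, exp_mul_I, ← ofReal_cos,
    ← ofReal_sin, ← ofReal_pow, show ((k : ℂ) + 1) = ((k + 1 : ℝ) : ℂ) by push_cast; rfl, mul_div_assoc,
    ← ofReal_div]
  simp only [add_im, ofReal_im, mul_im, ofReal_re, I_im, I_re]
  ring

theorem abs_sum_sin_le {a : ℝ} (ha : expo a ≠ 1) (N : ℕ) :
    |∑ k ∈ Finset.range N, Real.sin (2 * Real.pi * a * (k + 1))| ≤ 2 / ‖expo a - 1‖ := by
  have h1 : ∑ k ∈ Finset.range N, Real.sin (2 * Real.pi * a * (k + 1)) =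
      (∑ k ∈ Finset.range N, expo a ^ k * expo a).im := by
    rw [im_sum]
    refine Finset.sum_congr rfl fun k _ => ?_
    rw [← pow_succ, ← expo_nat_mul, expo, show (2 * Real.pi * I * (((k + 1 : ℕ) : ℂ) * (a : ℂ))) =
      ((2 * Real.pi * a * (k + 1) : ℝ) : ℂ) * I by push_cast; ring, exp_ofReal_mul_I_im]
  have hn : ‖expo a‖ = 1 := by
    rw [expo, show (2 * Real.pi * I * (a : ℂ)) = ((2 * Real.pi * a : ℝ) : ℂ) * I by
      push_cast; ring, norm_exp_ofReal_mul_I]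
  rw [h1, ← Finset.sum_mul, geom_sum_eq ha]
  refine (abs_im_le_norm _).trans ?_
  rw [norm_mul, hn, mul_one, norm_div]
  gcongr
  refine (norm_sub_le _ _).trans ?_
  rw [norm_pow, hn, one_pow, norm_one]
  norm_num

theorem expo_ofReal_ne_one {a : ℝ} (ha : 0 < a) (ha1 : a < 1) : expo a ≠ 1 := by
  rw [Ne, expo_eq_one_iff]
  rintro ⟨n, hn⟩
  have : a = n := by exact_mod_cast hn
  rw [this] at ha ha1
  have h1 : 0 < n := by exact_mod_cast ha
  have h2 : n < 1 := by exact_mod_cast ha1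
  omega

/-- The series ∑ sin(2πak)/k is evaluated twice. As the limit of its Dirichlet series at 1⁺ it is
the value of `sinZeta`; as the limit of its power series at 1⁻, by Abel's theorem, it is -arg(1 -
e(a)). -/
theorem sinZeta_one {a : ℝ} (ha : 0 < a) (ha1 : a < 1) :
    HurwitzZeta.sinZeta a 1 = (Real.pi * (1 / 2 - a) : ℝ) := by
  have hne := expo_ofReal_ne_one ha ha1
  let F : ℝ → ℝ := fun s => (HurwitzZeta.sinZeta a (s : ℂ)).re
  have hsum : ∀ s : ℝ, 1 < s → HasSum (fun k : ℕ =>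
      ((Real.sin (2 * Real.pi * a * (k + 1)) * ((k : ℝ) + 1) ^ (-s) : ℝ) : ℂ))
      (HurwitzZeta.sinZeta a (s : ℂ)) := by
    intro s hs
    have h := HurwitzZeta.hasSum_nat_sinZeta a (s := s) (by simpa using hs)
    rw [← hasSum_nat_add_iff' 1] at h
    simp only [Finset.range_one, Finset.sum_singleton, Nat.cast_zero, mul_zero, Real.sin_zero,
      ofReal_zero, zero_div, sub_zero] at h
    refine h.congr_fun fun k => ?_
    rw [ofReal_mul, ofReal_cpow (by positivity), div_eq_mul_inv, ofReal_neg, cpow_neg]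
    push_cast
    rfl
  have hF : ContinuousAt F 1 := by
    have := ((HurwitzZeta.differentiableAt_sinZeta a).continuous).comp continuous_ofReal
    exact (continuous_re.comp this).continuousAt
  have hreal : ∀ s : ℝ, 1 < s → HurwitzZeta.sinZeta a (s : ℂ) = (F s : ℂ) := by
    intro s hs
    obtain ⟨r, hr⟩ : ∃ r : ℝ, HurwitzZeta.sinZeta a (s : ℂ) = r :=
      ⟨_, (hsum s hs).tsum_eq.symm.trans (ofReal_tsum _).symm⟩
    simp only [F]
    rw [hr, ofReal_re]
  have key := tendsto_sum_div_of_bounded (abs_sum_sin_le hne) hF fun s hs => by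
    have := Complex.hasSum_re (hsum s hs)
    exact this
  have hval : F 1 = Real.pi * (1 / 2 - a) := by
    have h1 := Real.tendsto_tsum_powerSeries_nhdsWithin_lt key
    have h1' := h1.mul ((continuous_id (X := ℝ)).continuousAt.tendsto.mono_left
      (nhdsWithin_le_nhds (a := (1 : ℝ)) (s := Iio 1)))
    have h2 : Tendsto (fun x : ℝ => -(1 - expo a * x).arg) (𝓝[<] 1) (𝓝 (-(1 - expo a).arg)) := by
      have hc : ContinuousAt (fun x : ℝ => -(1 - expo a * x).arg) 1 := by
        have hslit : 1 - expo a * ((1 : ℝ) : ℂ) ∈ slitPlane := by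
          rw [ofReal_one, mul_one, mem_slitPlane_iff_arg, arg_one_sub_expo ha ha1]
          refine ⟨?_, sub_ne_zero.2 hne.symm⟩
          nlinarith [Real.pi_pos]
        exact (ContinuousAt.comp (f := fun x : ℝ => 1 - expo a * (x : ℂ)) (continuousAt_arg hslit)
          (by fun_prop)).neg
      have := hc.tendsto.mono_left (nhdsWithin_le_nhds (s := Iio 1))
      simpa using this
    have h3 := tendsto_nhds_unique (h1'.congr' ?_) h2
    · rw [id, mul_one, arg_one_sub_expo ha ha1] at h3
      rw [h3]; ring
    · filter_upwards [Ioo_mem_nhdsLT (show (0 : ℝ) < 1 by norm_num)] with x hx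
      rw [← (hasSum_sin_mul_pow_div hx.1.le hx.2).tsum_eq, tsum_mul_right, id]
  rw [← hval]
  have hc1 : Tendsto (fun s : ℝ => HurwitzZeta.sinZeta a (s : ℂ)) (𝓝[>] 1)
      (𝓝 (HurwitzZeta.sinZeta a 1)) := by
    have := (((HurwitzZeta.differentiableAt_sinZeta a).continuous).comp continuous_ofReal).continuousAt
      (x := (1 : ℝ))
    simpa using! this.tendsto.mono_left (nhdsWithin_le_nhds (s := Ioi 1))
  have hc2 : Tendsto (fun s : ℝ => ((F s : ℝ) : ℂ)) (𝓝[>] 1) (𝓝 (F 1 : ℂ)) :=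
    (continuous_ofReal.tendsto _).comp (hF.tendsto.mono_left nhdsWithin_le_nhds)
  refine tendsto_nhds_unique hc1 (hc2.congr' ?_)
  filter_upwards [self_mem_nhdsWithin] with s hs
  exact (hreal s hs).symm

/-- The functional equation at s = 1 turns the value at 0 into `sinZeta_one`. -/
theorem hurwitzZetaOdd_apply_zero {a : ℝ} (ha : 0 < a) (ha1 : a < 1) :
    HurwitzZeta.hurwitzZetaOdd a 0 = (1 / 2 - a : ℝ) := by
  have h := HurwitzZeta.hurwitzZetaOdd_one_sub (a : UnitAddCircle) (s := 1) (fun n h => by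
    have := congrArg re h
    simp at this
    linarith [(n.cast_nonneg : (0 : ℝ) ≤ n)])
  rw [sub_self, sinZeta_one ha ha1, cpow_neg_one, Gamma_one, mul_one, mul_one, sin_pi_div_two] at h
  rw [h]
  have : (Real.pi : ℂ) ≠ 0 := by exact_mod_cast Real.pi_ne_zero
  push_cast
  field_simp

/-- `L(0, χ)` for an odd Dirichlet character `χ`. -/
theorem LFunction_apply_zero_of_odd {N : ℕ} [NeZero N] {χ : DirichletCharacter ℂ N} (hχ : χ.Odd)
    (hN : 1 < N) :
    DirichletCharacter.LFunction χ 0 = ∑ j : ZMod N, χ j * (1 / 2 - (j.val : ℂ) / N) := by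
  have hN0 : (0 : ℝ) < N := by exact_mod_cast hN.trans' one_pos
  have : Fact (1 < N) := ⟨hN⟩
  rw [DirichletCharacter.LFunction, ZMod.LFunction_def_odd hχ.to_fun, neg_zero, cpow_zero, one_mul]
  refine Finset.sum_congr rfl fun j _ => ?_
  rcases eq_or_ne j 0 with rfl | hj
  · rw [MulChar.map_nonunit χ not_isUnit_zero]; simp
  · rw [ZMod.toAddCircle_apply, hurwitzZetaOdd_apply_zero]
    · push_cast; rfl
    · have : 0 < j.val := Nat.pos_of_ne_zero (by simpa [ZMod.val_eq_zero] using hj)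
      positivity
    · rw [div_lt_one hN0]
      exact_mod_cast ZMod.val_lt j

end PCore

end

/-! ### The mean Eisenstein series as a sum of four values of J -/

noncomputable section
namespace PCore
open Complex Filter Topology Set

/-- A quadruple `b₀, b₁, b₂ ∈ (0, p)`, `b₃ ∈ (-p, 0)` of sum zero for which the residues of
`k b₀, …, k b₃` in `(0, p)` have the sum `2p` for all `k ≢ 0, ±1 mod p`, the sum `p` for `k ≡ 1`
and the sum `3p` for `k ≡ -1`. -/
structure IsBalanced (p : ℕ) (b : Fin 4 → ℤ) : Prop where
  pos : ∀ i, i ≠ 3 → 0 < b i ∧ b i < p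
  neg : -p < b 3 ∧ b 3 < 0
  sum_eq_zero : ∑ i, b i = 0
  sum_val : ∀ k : ZMod p, k ≠ 0 →
    ∑ i, (k * (b i : ZMod p)).val = if k = 1 then p else if k = -1 then 3 * p else 2 * p

theorem nome_eq_expo (τ : UpperHalfPlane) : nome τ = expo τ := rfl

section
variable {p : ℕ} [hp : Fact p.Prime] {b : Fin 4 → ℤ}

omit hp in
theorem IsBalanced.not_dvd (hb : IsBalanced p b) (i : Fin 4) : ¬ (p : ℤ) ∣ b i := by
  have key : ∀ x : ℤ, x ≠ 0 → |x| < p → ¬ (p : ℤ) ∣ x := fun x h0 h1 h =>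
    absurd (Int.eq_zero_of_abs_lt_dvd h h1) h0
  rcases eq_or_ne i 3 with rfl | hi
  · exact key _ hb.neg.2.ne (by rw [abs_lt]; have := hb.neg; omega)
  · have := hb.pos i hi
    exact key _ this.1.ne' (by rw [abs_lt]; omega)

theorem IsBalanced.cast_ne_zero (hb : IsBalanced p b) (i : Fin 4) : (b i : ZMod p) ≠ 0 := by
  rw [Ne, ZMod.intCast_zmod_eq_zero_iff_dvd]
  exact hb.not_dvd i

/-- After substituting k bᵢ for the summation variable, the coefficient of χ(k) is 2 minus the sum
of the residues divided by p, that is 1 at k = 1, -1 at k = -1 and 0 at all other k ≠ 0. For odd χ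
the two surviving terms add up to 2. -/
theorem IsBalanced.LFunction_mul_sum (hb : IsBalanced p b) (hp2 : 2 < p)
    {χ : DirichletCharacter ℂ p} (hχ : χ.Odd) :
    DirichletCharacter.LFunction χ 0 * ∑ i, χ (b i : ZMod p)⁻¹ = 2 := by
  have hp0 : (p : ℂ) ≠ 0 := by exact_mod_cast hp.out.ne_zero
  have h2 : Fact (2 < p) := ⟨hp2⟩
  have h1 : ∀ i, χ (b i : ZMod p)⁻¹ * DirichletCharacter.LFunction χ 0 =
      ∑ k : ZMod p, χ k * (1 / 2 - ((k * (b i : ZMod p)).val : ℂ) / p) := by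
    intro i
    have hi := hb.cast_ne_zero i
    rw [LFunction_apply_zero_of_odd hχ hp.out.one_lt, Finset.mul_sum]
    refine (Fintype.sum_equiv (Equiv.mulRight₀ _ hi) _ _ fun k => ?_).symm
    change _ = χ (b i : ZMod p)⁻¹ * (χ (k * b i) * (1 / 2 - ((k * (b i : ZMod p)).val : ℂ) / p))
    rw [← mul_assoc, ← map_mul, mul_comm k, inv_mul_cancel_left₀ hi]
  have hne : (1 : ZMod p) ≠ -1 := (ZMod.neg_one_ne_one).symm
  have h3 : ∀ k : ZMod p, χ k * (∑ i, (1 / 2 - ((k * (b i : ZMod p)).val : ℂ) / p)) =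
      (if k = 1 then 1 else 0) + (if k = -1 then 1 else 0) := by
    intro k
    rcases eq_or_ne k 0 with rfl | hk
    · rw [MulChar.map_nonunit χ not_isUnit_zero, zero_mul, if_neg zero_ne_one,
        if_neg (neg_ne_zero.2 one_ne_zero).symm, add_zero]
    · have h4 : ∑ i, (1 / 2 - ((k * (b i : ZMod p)).val : ℂ) / p) =
          2 - ((∑ i, (k * (b i : ZMod p)).val : ℕ) : ℂ) / p := by
        rw [Fin.sum_univ_four, Fin.sum_univ_four]
        push_cast
        ring
      rw [h4, hb.sum_val k hk]
      split_ifs with h h' h'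
      · exact absurd (h.symm.trans h') hne
      · rw [h, map_one]; field_simp; norm_num
      · rw [h', hχ]; push_cast; field_simp; norm_num
      · push_cast; field_simp; norm_num
  rw [mul_comm, Finset.sum_mul, Finset.sum_congr rfl fun i _ => h1 i, Finset.sum_comm]
  simp only [← Finset.mul_sum, h3]
  rw [Finset.sum_add_distrib]
  simp
  norm_num

/-- The conductor is 1 or p, and the character of conductor 1 is even. -/
theorem isPrimitive_of_odd {χ : DirichletCharacter ℂ p} (hχ : χ.Odd) : χ.IsPrimitive := by
  rcases (Nat.dvd_prime hp.out).1 χ.conductor_dvd_level with h | h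
  · rw [← DirichletCharacter.eq_one_iff_conductor_eq_one] at h
    rw [h, DirichletCharacter.Odd, MulChar.one_apply (isUnit_one.neg)] at hχ
    norm_num at hχ
  · exact h

open scoped Classical in
-- Orthogonality over all characters, projected to the odd ones by (1 - χ(-1))/2.
theorem sum_odd_char {a : ZMod p} (ha : a ≠ 0) (n : ZMod p) :
    ∑ χ : DirichletCharacter ℂ p with χ.Odd, χ a⁻¹ * χ n =
      ((p : ℂ) - 1) / 2 * ((if n = a then 1 else 0) - if n = -a then 1 else 0) := by
  have h1 : ∀ χ : DirichletCharacter ℂ p, (if χ.Odd then χ a⁻¹ * χ n else 0) =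
      1 / 2 * (χ a⁻¹ * χ n - χ (-a)⁻¹ * χ n) := by
    intro χ
    rw [← neg_inv, show -a⁻¹ = -1 * a⁻¹ by ring, map_mul]
    rcases χ.even_or_odd with h | h
    · have h' : ¬ χ.Odd := fun h' => by
        have := h.symm.trans h'
        norm_num at this
      rw [if_neg h', h]; ring
    · rw [if_pos h, h]; ring
  rw [Finset.sum_filter, Finset.sum_congr rfl fun χ _ => h1 χ, ← Finset.mul_sum,
    Finset.sum_sub_distrib, DirichletCharacter.sum_char_inv_mul_char_eq ℂ ha.isUnit,
    DirichletCharacter.sum_char_inv_mul_char_eq ℂ (neg_ne_zero.2 ha).isUnit, Nat.totient_prime hp.out,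
    Nat.cast_sub hp.out.one_le]
  simp only [eq_comm (a := a), eq_comm (a := -a), Nat.cast_one]
  split_ifs <;> ring

/-- The summand `q^n / (1 - q^n)` of a Lambert series. -/
def lambertTerm (q : ℂ) (n : ℕ) : ℂ := q ^ n / (1 - q ^ n)

theorem summable_lambertTerm {q : ℂ} (hq : ‖q‖ < 1) : Summable fun n : ℕ => lambertTerm q n := by
  simpa [lambertTerm] using summable_div_one_sub hq 1

theorem hasSum_lambertTerm_residue {q : ℂ} (hq : ‖q‖ < 1) {a : ℕ} (ha : 0 < a) (hap : a < p) :
    HasSum (fun n : ℕ+ => (if ((n : ℕ) : ZMod p) = a then 1 else 0) * lambertTerm q n)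
      (∑' k : ℕ, q ^ a * (q ^ p) ^ k / (1 - q ^ a * (q ^ p) ^ k)) := by
  let g : ℕ → ℕ+ := fun k => ⟨a + p * k, by omega⟩
  have hg : Function.Injective g := fun k l h => by
    have : a + p * k = a + p * l := congrArg PNat.val h
    exact Nat.eq_of_mul_eq_mul_left hp.out.pos (by omega)
  have hterm : ∀ k, (if ((g k : ℕ) : ZMod p) = a then 1 else 0) * lambertTerm q (g k) =
      q ^ a * (q ^ p) ^ k / (1 - q ^ a * (q ^ p) ^ k) := by
    intro k
    have h : ((g k : ℕ) : ZMod p) = a := by simp [g]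
    rw [if_pos h, one_mul, ← pow_mul, ← pow_add]
    rfl
  have hqp : ‖q ^ p‖ < 1 := by
    rw [norm_pow]; exact pow_lt_one₀ (norm_nonneg _) hq hp.out.ne_zero
  have hs := (summable_div_one_sub hqp (q ^ a)).hasSum
  refine (hg.hasSum_iff fun n hn => ?_).1 (hs.congr_fun hterm)
  rw [if_neg, zero_mul]
  intro h
  apply hn
  rw [ZMod.natCast_eq_natCast_iff'] at h
  rw [Nat.mod_eq_of_lt hap] at h
  refine ⟨n / p, PNat.eq ?_⟩
  change a + p * ((n : ℕ) / p) = n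
  rw [← h]
  exact Nat.mod_add_div _ _

omit hp in
theorem ne_lattice_of_not_dvd (τ : UpperHalfPlane) {b : ℤ} (hb : ¬ (p : ℤ) ∣ b) :
    ∀ m n : ℤ, (b * τ : ℂ) ≠ m * (p * τ) + n := by
  intro m n h
  have him := congrArg im h
  simp at him
  have h1 : (b : ℝ) = m * p := mul_right_cancel₀ τ.im_pos.ne' (by linarith)
  exact hb ⟨m, by rw [mul_comm]; exact_mod_cast h1⟩

omit hp in
theorem im_nat_mul_pos (hp0 : 0 < p) (τ : UpperHalfPlane) : 0 < ((p : ℂ) * τ).im := by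
  have h : (0 : ℝ) < p := by exact_mod_cast hp0
  have := mul_pos h τ.im_pos
  simpa using this

/-- For x = aτ and T = pτ the two series of J run over the exponents a + pk and (p - a) + pk, the
positive integers congruent to a and to -a. -/
theorem hasSum_lambertTerm_diff (τ : UpperHalfPlane) {a : ℕ} (ha : 0 < a) (hap : a < p) :
    HasSum (fun n : ℕ+ => ((if ((n : ℕ) : ZMod p) = a then 1 else 0) -
      if ((n : ℕ) : ZMod p) = -a then 1 else 0) * lambertTerm (nome τ) n)
      (zetaQ (p * τ) (a * τ) - 1 / 2) := by
  have hq : ‖nome τ‖ < 1 := norm_expo_lt_one τ.im_pos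
  have hT := im_nat_mul_pos hp.out.pos τ
  have h1 := hasSum_lambertTerm_residue hq ha hap
  have h2 := hasSum_lambertTerm_residue (p := p) hq (a := p - a) (by omega) (by omega)
  have hnd : ¬ (p : ℤ) ∣ (a : ℤ) := by
    rw [Int.natCast_dvd_natCast]
    exact fun h => absurd (Nat.le_of_dvd ha h) (by omega)
  have hth := theta_ne_zero hT (ne_lattice_of_not_dvd τ hnd)
  rw [Int.cast_natCast] at hth
  have e1 : expo (a * τ) = nome τ ^ a := expo_nat_mul _ _
  have e2 : expo (p * τ) = nome τ ^ p := expo_nat_mul _ _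
  have e3 : nome τ ^ p * expo (-(a * τ)) = nome τ ^ (p - a) := by
    rw [expo_neg, e1, pow_sub₀ (nome τ) (expo_ne_zero _) hap.le]
  rw [zetaQ_eq_tsum hT hth, e1, e2, e3]
  have e4 : ((p - a : ℕ) : ZMod p) = -a := by
    rw [Nat.cast_sub hap.le, ZMod.natCast_self, zero_sub]
  rw [e4] at h2
  convert! h1.sub h2 using 1
  · funext n; ring
  · ring

open scoped Classical in
-- By balancedness 2/L(0, χ) is a sum of four character values, so orthogonality applies to the
-- mean. The constants -1/2 at b₀, b₁, b₂ and +1/2 at b₃ add up to -1 and cancel the constant term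
-- of the Eisenstein series.
theorem eisensteinMean_eq (hb : IsBalanced p b) (hp2 : 2 < p) (τ : UpperHalfPlane) :
    eisensteinMean p τ = ∑ i, zetaQ (p * τ) (b i * τ) := by
  have hq : ‖nome τ‖ < 1 := norm_expo_lt_one τ.im_pos
  have hT := im_nat_mul_pos hp.out.pos τ
  have hp1 : (p : ℂ) - 1 ≠ 0 := by
    rw [sub_ne_zero]
    exact_mod_cast hp.out.one_lt.ne'
  have hL : Summable fun n : ℕ+ => lambertTerm (nome τ) n :=
    (summable_lambertTerm hq).comp_injective PNat.coe_injective
  have hS : ∀ χ : DirichletCharacter ℂ p,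
      Summable fun n : ℕ+ => χ ((n : ℕ) : ZMod p) * lambertTerm (nome τ) n := by
    intro χ
    refine Summable.of_norm_bounded hL.norm fun n => ?_
    rw [norm_mul]
    exact mul_le_of_le_one_left (norm_nonneg _) (χ.norm_le_one _)
  have hχ : ∀ χ : DirichletCharacter ℂ p, χ.Odd → eisenstein 1 χ τ = 1 + ∑ i,
      ∑' n : ℕ+, χ (b i : ZMod p)⁻¹ * χ ((n : ℕ) : ZMod p) * lambertTerm (nome τ) n := by
    intro χ hχ
    have h := hb.LFunction_mul_sum hp2 hχ
    have hL0 : DirichletCharacter.LFunction χ 0 ≠ 0 := left_ne_zero_of_mul (by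
      rw [h]; exact two_ne_zero)
    have h' : 2 / DirichletCharacter.LFunction χ 0 = ∑ i, χ (b i : ZMod p)⁻¹ := by
      rw [div_eq_iff hL0, ← h, mul_comm]
    rw [eisenstein, Nat.cast_one, sub_self, h', Finset.sum_mul]
    congr 1
    refine Finset.sum_congr rfl fun i _ => ?_
    rw [← tsum_mul_left]
    refine tsum_congr fun n => ?_
    rw [Nat.sub_self, pow_zero, one_mul, lambertTerm, mul_assoc]
  have hfilter : (Finset.univ.filter fun χ : DirichletCharacter ℂ p => χ.Odd ∧ χ.IsPrimitive) =
      Finset.univ.filter fun χ => χ.Odd :=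
    Finset.filter_congr fun χ _ => ⟨fun h => h.1, fun h => ⟨h, isPrimitive_of_odd h⟩⟩
  have hcard : ∑ χ : DirichletCharacter ℂ p with χ.Odd, (1 : ℂ) = ((p : ℂ) - 1) / 2 := by
    have : Fact (2 < p) := ⟨hp2⟩
    have := sum_odd_char (one_ne_zero (α := ZMod p)) 1
    rw [if_pos rfl, if_neg (ZMod.neg_one_ne_one).symm, sub_zero, mul_one] at this
    rw [← this]
    exact Finset.sum_congr rfl fun χ _ => by simp
  have hinner : ∀ i, ∑ χ : DirichletCharacter ℂ p with χ.Odd,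
      ∑' n : ℕ+, χ (b i : ZMod p)⁻¹ * χ ((n : ℕ) : ZMod p) * lambertTerm (nome τ) n =
      ((p : ℂ) - 1) / 2 * ∑' n : ℕ+, ((if ((n : ℕ) : ZMod p) = b i then 1 else 0) -
        if ((n : ℕ) : ZMod p) = -b i then 1 else 0) * lambertTerm (nome τ) n := by
    intro i
    rw [← Summable.tsum_finsetSum, ← tsum_mul_left]
    · refine tsum_congr fun n => ?_
      rw [← Finset.sum_mul, sum_odd_char (hb.cast_ne_zero i), mul_assoc]
    · intro χ _
      simpa only [mul_assoc] using (hS χ).mul_left (χ (b i : ZMod p)⁻¹)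
  rw [eisensteinMean, hfilter, Finset.sum_congr rfl fun χ h => hχ χ (Finset.mem_filter.1 h).2,
    Finset.sum_add_distrib, hcard, Finset.sum_comm, Finset.sum_congr rfl fun i _ => hinner i,
    ← Finset.mul_sum, mul_add]
  have hz : ∀ i, i ≠ 3 → ∑' n : ℕ+, ((if ((n : ℕ) : ZMod p) = b i then (1 : ℂ) else 0) -
        if ((n : ℕ) : ZMod p) = -b i then 1 else 0) * lambertTerm (nome τ) n =
      zetaQ (p * τ) (b i * τ) - 1 / 2 := by
    intro i hi
    obtain ⟨h1, h2⟩ := hb.pos i hi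
    obtain ⟨a, ha⟩ := Int.eq_ofNat_of_zero_le h1.le
    rw [ha] at h1 h2 ⊢
    have := (hasSum_lambertTerm_diff (p := p) τ (a := a) (by omega) (by omega)).tsum_eq
    simpa using this
  -- b₃ is negative, so the residue used is b₃ + p; the shift by T raises J by 1 and turns -1/2 into
  -- +1/2.
  have hz3 : ∑' n : ℕ+, ((if ((n : ℕ) : ZMod p) = b 3 then (1 : ℂ) else 0) -
        if ((n : ℕ) : ZMod p) = -b 3 then 1 else 0) * lambertTerm (nome τ) n =
      zetaQ (p * τ) (b 3 * τ) + 1 / 2 := by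
    obtain ⟨h1, h2⟩ := hb.neg
    obtain ⟨a, ha⟩ := Int.eq_ofNat_of_zero_le (show 0 ≤ b 3 + p by omega)
    have h3 := (hasSum_lambertTerm_diff (p := p) τ (a := a) (by omega) (by omega)).tsum_eq
    have hb3 : (a : ℤ) = b 3 + p := ha.symm
    have e1 : ((a : ℕ) : ZMod p) = (b 3 : ZMod p) := by
      rw [← Int.cast_natCast (R := ZMod p), hb3]; simp
    have e2 : ((a : ℂ) * τ) = b 3 * τ + p * τ := by
      rw [← Int.cast_natCast (R := ℂ), hb3]; push_cast; ring
    rw [e1, e2, zetaQ_add_period hT (theta_ne_zero hT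
      (ne_lattice_of_not_dvd τ (hb.not_dvd 3)))] at h3
    rw [h3]; ring
  rw [Fin.sum_univ_four, Fin.sum_univ_four, hz 0 (by decide), hz 1 (by decide), hz 2 (by decide), hz3]
  field_simp
  ring

/-- The diamond operators act on `eisensteinMean` by multiplication of the arguments of `J`. -/
theorem diamond_eisensteinMean (hb : IsBalanced p b) (hp2 : 2 < p)
    (γ : CongruenceSubgroup.Gamma0 p) (τ : UpperHalfPlane) :
    diamond 1 γ (eisensteinMean p) τ =
      ∑ i, zetaQ (p * τ) ((b i * (γ : SL(2, ℤ)) 0 0 : ℤ) * τ) := by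
  set g : SL(2, ℤ) := (γ : SL(2, ℤ)) with hg
  obtain ⟨c', hc'⟩ : (p : ℤ) ∣ g 1 0 := by
    rw [← ZMod.intCast_zmod_eq_zero_iff_dvd]
    exact CongruenceSubgroup.Gamma0_mem.1 γ.2
  have hdet : g 0 0 * g 1 1 - g 0 1 * g 1 0 = 1 := by
    have := g.det_coe
    rwa [Matrix.det_fin_two] at this
  set A := g 0 0 with hA
  set B := g 0 1 with hB
  set D := g 1 1 with hD
  rw [hc'] at hdet
  have hp0 : (p : ℂ) ≠ 0 := by exact_mod_cast hp.out.ne_zero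
  let j : ℂ := p * c' * τ + D
  have hj0 : j ≠ 0 := by
    have := UpperHalfPlane.denom_ne_zero g τ
    rw [UpperHalfPlane.denom] at this
    simp at this
    rw [← hD] at this
    convert this using 2
    rw [hc']; push_cast; ring
  have hgτ : ((g • τ : UpperHalfPlane) : ℂ) = (A * τ + B) / j := by
    rw [UpperHalfPlane.coe_specialLinearGroup_apply]
    simp only [algebraMap_int_eq, eq_intCast, ofReal_intCast]
    rw [hc', ← hA, ← hB, ← hD]
    push_cast
    rfl
  rw [diamond_apply, eisensteinMean_eq hb hp2, ← hg, hc']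
  let T : UpperHalfPlane := ⟨p * τ, im_nat_mul_pos hp.out.pos τ⟩
  let T' : UpperHalfPlane := ⟨p * (g • τ : UpperHalfPlane), im_nat_mul_pos hp.out.pos _⟩
  have hAp : ¬ (p : ℤ) ∣ A := by
    rintro ⟨a, ha⟩
    rw [ha] at hdet
    have : (p : ℤ) ∣ 1 := ⟨a * D - B * c', by rw [← hdet]; ring⟩
    exact hp.out.one_lt.ne' (by exact_mod_cast Int.eq_one_of_dvd_one (by positivity) this)
  have hpI : Prime (p : ℤ) := Nat.prime_iff_prime_int.1 hp.out
  have hndA : ∀ i, ¬ (p : ℤ) ∣ b i * A := fun i h =>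
    (hpI.dvd_or_dvd h).elim (hb.not_dvd i) hAp
  have h1 := tsum_latticeTerm T' (x := fun i => (b i : ℂ) * (g • τ : UpperHalfPlane))
    (by rw [← Finset.sum_mul, ← Int.cast_sum, hb.sum_eq_zero]; simp)
    (fun i m n => ne_lattice_of_not_dvd _ (hb.not_dvd i) m n)
  have hne2 : ∀ i, ∀ m n : ℤ, (b i * (A * τ + B) : ℂ) ≠ m * T + n := by
    intro i m n h
    refine ne_lattice_of_not_dvd τ (hndA i) m (n - b i * B) ?_
    change (b i * (A * τ + B) : ℂ) = m * (p * τ) + n at h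
    push_cast
    linear_combination h
  have h2 := tsum_latticeTerm T (x := fun i => (b i : ℂ) * (A * τ + B))
    (by rw [← Finset.sum_mul, ← Int.cast_sum, hb.sum_eq_zero]; simp) hne2
  -- Since p divides γ₂₁, multiplication by j = γ₂₁τ + γ₂₂ maps ℤ + ℤpγ(τ) onto ℤ + ℤpτ; this is the
  -- map in coordinates.
  let e : ℤ × ℤ ≃ ℤ × ℤ :=
    { toFun := fun v => (v.1 * A + v.2 * c', v.1 * (p * B) + v.2 * D)
      invFun := fun v => (v.1 * D - v.2 * c', -v.1 * (p * B) + v.2 * A)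
      left_inv := fun v => by
        ext
        · simp only; linear_combination v.1 * hdet
        · simp only; linear_combination v.2 * hdet
      right_inv := fun v => by
        ext
        · simp only; linear_combination v.1 * hdet
        · simp only; linear_combination v.2 * hdet }
  -- The lattice summand is homogeneous of degree -1, and the resulting factor j is cancelled by the
  -- weight factor of the slash action.
  have hterm : ∀ v : ℤ × ℤ, latticeTerm (fun i => (b i : ℂ) * (g • τ : UpperHalfPlane))
      (v.1 * T' + v.2) =
      j * latticeTerm (fun i => (b i : ℂ) * (A * τ + B)) ((e v).1 * T + (e v).2) := by
    intro v
    have hω : ((v.1 : ℂ) * T' + v.2) = (((e v).1 : ℂ) * T + (e v).2) / j := by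
      change (v.1 : ℂ) * (p * (g • τ : UpperHalfPlane)) + v.2 =
        (((v.1 * A + v.2 * c' : ℤ) : ℂ) * (p * τ) + ((v.1 * (p * B) + v.2 * D : ℤ) : ℂ)) / j
      rw [hgτ, eq_div_iff hj0]
      have : (v.1 : ℂ) * (p * ((A * τ + B) / j)) * j = v.1 * (p * (A * τ + B)) := by
        field_simp
      rw [add_mul, this]
      push_cast
      simp only [j]
      ring
    rw [hω, hgτ]
    simp only [latticeTerm, Finset.mul_sum]
    refine Finset.sum_congr rfl fun i _ => ?_
    generalize ((e v).1 : ℂ) * T + (e v).2 = ω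
    rw [← mul_div_assoc, div_pow, div_pow, ← sub_div]
    rcases eq_or_ne (((b i : ℂ) * (A * τ + B)) ^ 2 - ω ^ 2) 0 with h0 | h0
    · rw [h0]; simp
    · field_simp
  have h3 : ∑' v : ℤ × ℤ, latticeTerm (fun i => (b i : ℂ) * (g • τ : UpperHalfPlane))
      (v.1 * T' + v.2) =
      j * ∑' v : ℤ × ℤ, latticeTerm (fun i => (b i : ℂ) * (A * τ + B)) (v.1 * T + v.2) := by
    rw [← tsum_mul_left]
    exact (tsum_congr hterm).trans (e.tsum_eq fun v =>
      j * latticeTerm (fun i => (b i : ℂ) * (A * τ + B)) (v.1 * T + v.2))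
  rw [h1, h2] at h3
  have h4 : ∑ i, zetaQ (p * (g • τ : UpperHalfPlane)) (b i * (g • τ : UpperHalfPlane)) =
      j * ∑ i, zetaQ (p * τ) (b i * (A * τ + B)) := by
    refine mul_left_cancel₀ (neg_ne_zero.2 two_pi_I_ne_zero) ?_
    linear_combination h3
  rw [h4]
  have h5 : (((p * c' : ℤ) : ℂ) * τ + D) = j := by push_cast; rfl
  rw [h5, zpow_neg_one, inv_mul_cancel_left₀ hj0]
  refine Finset.sum_congr rfl fun i _ => ?_
  -- The translation part bᵢB is an integer, a period of J.
  rw [← zetaQ_add_int ((b i * A : ℤ) * τ) (b i * B)]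
  congr 1
  push_cast
  ring

end
end PCore

end

/-! ### Theta quotients and products over half systems -/

noncomputable section
namespace PCore
open Complex Filter Topology Set

/-- The residue of `n` up to sign, in `[0, p / 2]`. -/
def absResidue (p : ℕ) (n : ℤ) : ℤ := if 2 * (n % p) < p then n % p else p - n % p

/-- The sign in the reduction of `thetaInt p τ n` to `absResidue p n`. -/
def residueSign (p : ℕ) (n : ℤ) : ℤ := if Even (n / p) then 1 else -1

/-- The theta function at `nτ` with a factor that makes it odd and antiperiodic in `n`. -/
def thetaInt (p : ℕ) (τ : UpperHalfPlane) (n : ℤ) : ℂ :=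
  expo ((n * (n - p) : ℂ) / (2 * p) * τ) * theta (p * τ) (n * τ)

/-- The smallest inverse of `a` modulo the prime `p`. -/
def invIndex (p a : ℕ) : ℤ := ((a ^ (p - 2) % p : ℕ) : ℤ)

section
variable {p : ℕ} [hp : Fact p.Prime]

theorem thetaInt_neg (τ : UpperHalfPlane) (n : ℤ) : thetaInt p τ (-n) = -thetaInt p τ n := by
  have hp0 : (p : ℂ) ≠ 0 := by exact_mod_cast hp.out.ne_zero
  have h : expo ((-n : ℂ) * (-n - p) / (2 * p) * τ) * expo (-(n * τ)) =
      expo ((n * (n - p) : ℂ) / (2 * p) * τ) := by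
    rw [← expo_add]; congr 1; field_simp; ring
  rw [thetaInt, Int.cast_neg, neg_mul (n : ℂ) (τ : ℂ), theta_neg (im_nat_mul_pos hp.out.pos τ),
    thetaInt, ← h]
  ring

theorem thetaInt_add (τ : UpperHalfPlane) (n : ℤ) : thetaInt p τ (n + p) = -thetaInt p τ n := by
  have hp0 : (p : ℂ) ≠ 0 := by exact_mod_cast hp.out.ne_zero
  have h : expo (((n : ℂ) + p) * (n + p - p) / (2 * p) * τ) * expo (-(n * τ)) =
      expo ((n * (n - p) : ℂ) / (2 * p) * τ) := by
    rw [← expo_add]; congr 1; field_simp; ring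
  rw [thetaInt, Int.cast_add, Int.cast_natCast, add_mul (n : ℂ) _ (τ : ℂ),
    theta_add_period (im_nat_mul_pos hp.out.pos τ), thetaInt, ← h]
  ring

theorem thetaInt_add_mul (τ : UpperHalfPlane) (n m : ℤ) :
    thetaInt p τ (n + p * m) = (if Even m then 1 else -1) * thetaInt p τ n := by
  induction m with
  | zero => simp
  | succ k ih =>
    rw [mul_add, mul_one, ← add_assoc, thetaInt_add, ih]
    by_cases h : Even (k : ℤ) <;> simp only [Int.even_add_one, h] <;> simp
  | pred k ih =>
    have := thetaInt_add (p := p) τ (n + p * (-(k : ℤ) - 1))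
    rw [show n + p * (-(k : ℤ) - 1) + p = n + p * -(k : ℤ) by ring, ih] at this
    rw [← neg_eq_iff_eq_neg] at this
    rw [← this]
    by_cases h : Even (-(k : ℤ)) <;> simp only [Int.even_sub_one, h] <;> simp

theorem thetaInt_eq (τ : UpperHalfPlane) (n : ℤ) :
    thetaInt p τ n = residueSign p n * thetaInt p τ (absResidue p n) := by
  have h : thetaInt p τ (n % p) = thetaInt p τ (absResidue p n) := by
    rw [absResidue]
    split_ifs
    · rfl
    · rw [sub_eq_neg_add, thetaInt_add, thetaInt_neg, neg_neg]
  conv_lhs => rw [← Int.emod_add_mul_ediv n p]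
  rw [thetaInt_add_mul, h, residueSign]
  push_cast
  rfl

/-- A product of values of `thetaInt` over a half system of residues modulo `p`. -/
theorem prod_thetaInt (τ : UpperHalfPlane) {S : Finset ℕ} {k : ℕ → ℤ} {h : ℕ} {c : ℤ}
    (hcard : S.card = h)
    (himage : S.image (fun a => absResidue p (k a * c)) = Finset.Icc (1 : ℤ) h) :
    ∏ a ∈ S, thetaInt p τ (k a * c) = ((∏ a ∈ S, residueSign p (k a * c) : ℤ) : ℂ) *
      ∏ j ∈ Finset.Icc (1 : ℤ) h, thetaInt p τ j := by
  have hinj : Set.InjOn (fun a => absResidue p (k a * c)) S := by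
    rw [← Finset.card_image_iff, himage, hcard]
    simp
  rw [← himage, Finset.prod_image hinj, Int.cast_prod, ← Finset.prod_mul_distrib]
  exact Finset.prod_congr rfl fun a _ => thetaInt_eq τ _

/-- The addition formula at the points k bᵢ τ. It survives the passage from θ to `thetaInt`, because
(x+y)² + (x+z)² + (y+z)² = x² + y² + z² + (x+y+z)² and the linear terms agree as well, so the
exponential factors cancel. -/
theorem sum_zetaQ_eq (τ : UpperHalfPlane) {b : Fin 4 → ℤ} {k : ℤ} (hb : IsBalanced p b)
    (hk : ¬ (p : ℤ) ∣ k) (hb12 : ¬ (p : ℤ) ∣ b 1 - b 2) :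
    ∑ i, zetaQ (p * τ) ((b i * k : ℤ) * τ) = qPoch (nome τ ^ p) (nome τ ^ p) ^ 2 *
      (thetaInt p τ (k * (b 1 + b 2)) * thetaInt p τ (k * (b 0 + b 1)) *
        thetaInt p τ (k * (b 0 + b 2))) /
      (thetaInt p τ (k * b 0) * thetaInt p τ (k * b 1) * thetaInt p τ (k * b 2) *
        thetaInt p τ (k * (b 0 + b 1 + b 2))) := by
  have hT := im_nat_mul_pos hp.out.pos τ
  have hp0 : (p : ℂ) ≠ 0 := by exact_mod_cast hp.out.ne_zero
  have hpI : Prime (p : ℤ) := Nat.prime_iff_prime_int.1 hp.out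
  have hnd : ∀ {x : ℤ}, ¬ (p : ℤ) ∣ x → theta (p * τ) ((k * x : ℤ) * τ) ≠ 0 := fun hx =>
    theta_ne_zero hT (ne_lattice_of_not_dvd τ fun h => (hpI.dvd_or_dvd h).elim hk hx)
  have hsum := hb.sum_eq_zero
  rw [Fin.sum_univ_four] at hsum
  have hb3 : b 3 = -(b 0 + b 1 + b 2) := by linarith
  have h012 : ¬ (p : ℤ) ∣ b 0 + b 1 + b 2 := fun h => hb.not_dvd 3 (by rw [hb3]; exact h.neg_right)
  have e1 : ((k * b 0 : ℤ) : ℂ) * τ + (((k * b 1 : ℤ) : ℂ) * τ + ((k * b 2 : ℤ) : ℂ) * τ) =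
      ((k * (b 0 + b 1 + b 2) : ℤ) : ℂ) * τ := by push_cast; ring
  have e2 : ((k * b 1 : ℤ) : ℂ) * τ - ((k * b 2 : ℤ) : ℂ) * τ =
      ((k * (b 1 - b 2) : ℤ) : ℂ) * τ := by push_cast; ring
  have e3 : ∀ x y : ℤ, ((k * x : ℤ) : ℂ) * τ + ((k * y : ℤ) : ℂ) * τ =
      ((k * (x + y) : ℤ) : ℂ) * τ := fun x y => by push_cast; ring
  have main := zetaQ_sum_eq hT (hnd (hb.not_dvd 0)) (hnd (hb.not_dvd 1)) (hnd (hb.not_dvd 2))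
    (by rw [e1]; exact hnd h012) (by rw [e2]; exact hnd hb12)
  rw [e1, e3, e3, e3, sub_eq_add_neg, ← zetaQ_neg hT] at main
  have e4 : -(((k * (b 0 + b 1 + b 2) : ℤ) : ℂ) * τ) = ((b 3 * k : ℤ) : ℂ) * τ := by
    rw [hb3]; push_cast; ring
  have hexp : expo ((k * (b 1 + b 2) : ℤ) * ((k * (b 1 + b 2) : ℤ) - p : ℂ) / (2 * p) * τ) *
      expo ((k * (b 0 + b 1) : ℤ) * ((k * (b 0 + b 1) : ℤ) - p : ℂ) / (2 * p) * τ) *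
      expo ((k * (b 0 + b 2) : ℤ) * ((k * (b 0 + b 2) : ℤ) - p : ℂ) / (2 * p) * τ) =
      expo ((k * b 0 : ℤ) * ((k * b 0 : ℤ) - p : ℂ) / (2 * p) * τ) *
      expo ((k * b 1 : ℤ) * ((k * b 1 : ℤ) - p : ℂ) / (2 * p) * τ) *
      expo ((k * b 2 : ℤ) * ((k * b 2 : ℤ) - p : ℂ) / (2 * p) * τ) *
      expo ((k * (b 0 + b 1 + b 2) : ℤ) * ((k * (b 0 + b 1 + b 2) : ℤ) - p : ℂ) / (2 * p) * τ) := by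
    simp only [← expo_add]
    congr 1
    push_cast
    field_simp
    ring
  rw [Fin.sum_univ_four, ← e4, mul_comm (b 0), mul_comm (b 1), mul_comm (b 2), main,
    show nome τ ^ p = expo (p * τ) from (expo_nat_mul _ _).symm]
  unfold thetaInt
  rw [show ∀ u x₁ y₁ x₂ y₂ x₃ y₃ : ℂ, u * (x₁ * y₁ * (x₂ * y₂) * (x₃ * y₃)) =
    (x₁ * x₂ * x₃) * (u * (y₁ * y₂ * y₃)) by intros; ring, hexp,
    show ∀ x₁ y₁ x₂ y₂ x₃ y₃ x₄ y₄ : ℂ, x₁ * y₁ * (x₂ * y₂) * (x₃ * y₃) * (x₄ * y₄) =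
    (x₁ * x₂ * x₃ * x₄) * (y₁ * y₂ * y₃ * y₄) by intros; ring, mul_div_mul_left]
  simp only [mul_ne_zero_iff]
  exact ⟨⟨⟨expo_ne_zero _, expo_ne_zero _⟩, expo_ne_zero _⟩, expo_ne_zero _⟩

/-- The sum of the `J(bᵢkτ)` depends on `k` modulo `p` only. -/
theorem sum_zetaQ_congr (τ : UpperHalfPlane) {b : Fin 4 → ℤ} {k l : ℤ} (hb : IsBalanced p b)
    (hk : ¬ (p : ℤ) ∣ k) (hkl : (p : ℤ) ∣ l - k) :
    ∑ i, zetaQ (p * τ) ((b i * l : ℤ) * τ) = ∑ i, zetaQ (p * τ) ((b i * k : ℤ) * τ) := by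
  have hT := im_nat_mul_pos hp.out.pos τ
  have hpI : Prime (p : ℤ) := Nat.prime_iff_prime_int.1 hp.out
  obtain ⟨m, hm⟩ := hkl
  have h : ∀ i, zetaQ (p * τ) ((b i * l : ℤ) * τ) =
      zetaQ (p * τ) ((b i * k : ℤ) * τ) + (b i * m : ℤ) := by
    intro i
    rw [← zetaQ_add_int_mul_period hT]
    · congr 1
      rw [sub_eq_iff_eq_add.1 hm]
      push_cast
      ring
    · exact theta_ne_zero hT (ne_lattice_of_not_dvd τ fun h =>
        (hpI.dvd_or_dvd h).elim (hb.not_dvd i) hk)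
  rw [Finset.sum_congr rfl fun i _ => h i, Finset.sum_add_distrib, ← Int.cast_sum,
    ← Finset.sum_mul, hb.sum_eq_zero]
  simp

/-- The factors 1 - q^n are grouped by the residue of n modulo m. -/
theorem qPoch_eq_prod {q : ℂ} (hq : ‖q‖ < 1) {m : ℕ} (hm : m ≠ 0) :
    qPoch q q = ∏ j ∈ Finset.range m, qPoch (q ^ (j + 1)) (q ^ m) := by
  have hqm : ‖q ^ m‖ < 1 := by
    rw [norm_pow]; exact pow_lt_one₀ (norm_nonneg _) hq hm
  have h1 : Tendsto (fun N => ∏ k ∈ Finset.range (m * N), (1 - q * q ^ k)) atTop (𝓝 (qPoch q q)) :=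
    (multipliable_qPoch q q hq).hasProd.tendsto_prod_nat.comp
      (tendsto_id.const_mul_atTop' (Nat.pos_of_ne_zero hm))
  have h2 : Tendsto (fun N => ∏ j ∈ Finset.range m, ∏ k ∈ Finset.range N,
      (1 - q ^ (j + 1) * (q ^ m) ^ k)) atTop
      (𝓝 (∏ j ∈ Finset.range m, qPoch (q ^ (j + 1)) (q ^ m))) :=
    tendsto_finsetProd _ fun j _ =>
      (multipliable_qPoch (q ^ (j + 1)) (q ^ m) hqm).hasProd.tendsto_prod_nat
  refine tendsto_nhds_unique h1 (h2.congr fun N => ?_)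
  induction N with
  | zero => simp
  | succ N ih =>
    rw [mul_add, mul_one, Finset.prod_range_add, ← ih, ← Finset.prod_mul_distrib]
    refine Finset.prod_congr rfl fun j _ => ?_
    rw [Finset.prod_range_succ]
    congr 2
    ring

/-- θ(jτ) contributes the factors 1 - q^n with n ≡ ±j mod p. For 1 ≤ j ≤ h these are all classes but
that of 0, which is supplied by (q^p; q^p). The exponential factors multiply to q^(-e). -/
theorem prod_thetaInt_Icc (τ : UpperHalfPlane) {h e : ℕ} (hph : p = 2 * h + 1)
    (he : ∑ j ∈ Finset.Icc (1 : ℤ) h, j * (p - j) = 2 * p * e) :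
    nome τ ^ e * (qPoch (nome τ ^ p) (nome τ ^ p) * ∏ j ∈ Finset.Icc (1 : ℤ) h, thetaInt p τ j) =
      qPoch (nome τ) (nome τ) := by
  have hp0 : (p : ℂ) ≠ 0 := by exact_mod_cast hp.out.ne_zero
  have hq : ‖nome τ‖ < 1 := norm_expo_lt_one τ.im_pos
  set q := nome τ with hqdef
  have hIcc : ∀ f : ℤ → ℂ, ∏ j ∈ Finset.Icc (1 : ℤ) h, f j =
      ∏ j ∈ Finset.range h, f ((j : ℤ) + 1) := by
    intro f
    refine (Finset.prod_bij (fun (j : ℕ) _ => (j : ℤ) + 1) (fun j hj => ?_) (fun _ _ _ _ h => by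
      simpa using h) (fun j hj => ?_) fun _ _ => rfl).symm
    · rw [Finset.mem_range] at hj
      rw [Finset.mem_Icc]
      omega
    · rw [Finset.mem_Icc] at hj
      exact ⟨(j - 1).toNat, by rw [Finset.mem_range]; omega, by omega⟩
  have hexp : ∏ j ∈ Finset.Icc (1 : ℤ) h, expo ((j * (j - p) : ℂ) / (2 * p) * τ) = (q ^ e)⁻¹ := by
    have hprod : ∀ (s : Finset ℤ) (f : ℤ → ℂ), ∏ j ∈ s, expo (f j) = expo (∑ j ∈ s, f j) := by
      intro s f
      induction s using Finset.cons_induction with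
      | empty => simp [expo_zero]
      | cons a s ha ih => rw [Finset.prod_cons, Finset.sum_cons, expo_add, ih]
    rw [hprod, ← Finset.sum_mul, hqdef, nome_eq_expo, ← expo_nat_mul, ← expo_neg]
    congr 1
    rw [← neg_mul]
    congr 1
    have hc : ∑ j ∈ Finset.Icc (1 : ℤ) h, ((j * (p - j) : ℂ)) = 2 * p * e := by
      exact_mod_cast congrArg (Int.cast : ℤ → ℂ) he
    rw [← Finset.sum_div, div_eq_iff (by simp [hp0])]
    have hneg : ∑ j ∈ Finset.Icc (1 : ℤ) h, ((j * (j - p) : ℂ)) =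
        -∑ j ∈ Finset.Icc (1 : ℤ) h, ((j * (p - j) : ℂ)) := by
      rw [← Finset.sum_neg_distrib]
      exact Finset.sum_congr rfl fun j _ => by ring
    rw [hneg, hc]
    ring
  have htheta : ∏ j ∈ Finset.Icc (1 : ℤ) h, theta (p * τ) (j * τ) =
      ∏ j ∈ Finset.range (2 * h), qPoch (q ^ (j + 1)) (q ^ p) := by
    have hterm : ∀ j ∈ Finset.range h, theta (p * τ) (((j : ℤ) + 1 : ℤ) * τ) =
        qPoch (q ^ (j + 1)) (q ^ p) * qPoch (q ^ (p - (j + 1))) (q ^ p) := by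
      intro j hj
      rw [Finset.mem_range] at hj
      have e1 : expo (((j : ℤ) + 1 : ℤ) * τ) = q ^ (j + 1) := by
        rw [hqdef, nome_eq_expo, ← expo_nat_mul]; push_cast; rfl
      have e2 : expo (p * τ) = q ^ p := expo_nat_mul _ _
      rw [theta, expo_neg, e1, e2, pow_sub₀ q (expo_ne_zero _) (by omega : j + 1 ≤ p)]
    rw [hIcc, Finset.prod_congr rfl hterm, Finset.prod_mul_distrib, two_mul, Finset.prod_range_add]
    congr 1
    rw [← Finset.prod_range_reflect]
    refine Finset.prod_congr rfl fun j hj => ?_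
    rw [Finset.mem_range] at hj
    congr 2
    omega
  have hall := qPoch_eq_prod hq hp.out.ne_zero
  conv_rhs at hall => rw [hph]
  rw [Finset.prod_range_succ, ← hph] at hall
  unfold thetaInt
  rw [Finset.prod_mul_distrib, hexp, htheta, hall]
  have : q ^ e ≠ 0 := pow_ne_zero _ (expo_ne_zero _)
  field_simp

/-- The product formula for the Eisenstein series, from a balanced quadruple and a half system
of residues. -/
theorem prod_diamond_eisensteinMean (τ : UpperHalfPlane) {b : Fin 4 → ℤ} {S : Finset ℕ} {h e : ℕ}
    (hb : IsBalanced p b) (hp2 : 2 < p) (hb12 : ¬ (p : ℤ) ∣ b 1 - b 2)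
    (hcop : ∀ a ∈ S, ¬ p ∣ a) (hcard : S.card = h) (hph : p = 2 * h + 1)
    (he : ∑ j ∈ Finset.Icc (1 : ℤ) h, j * (p - j) = 2 * p * e)
    (himage : ∀ c ∈ [b 1 + b 2, b 0 + b 1, b 0 + b 2, b 0, b 1, b 2, b 0 + b 1 + b 2],
      S.image (fun a => absResidue p (invIndex p a * c)) = Finset.Icc (1 : ℤ) h)
    (hsign : ([b 1 + b 2, b 0 + b 1, b 0 + b 2].map fun c =>
        ∏ a ∈ S, residueSign p (invIndex p a * c)).prod =
      ([b 0, b 1, b 2, b 0 + b 1 + b 2].map fun c =>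
        ∏ a ∈ S, residueSign p (invIndex p a * c)).prod)
    (γ : ℕ → CongruenceSubgroup.Gamma0 p) (hγ : ∀ a ∈ S, Represents (γ a) a) :
    nome τ ^ e * (qPoch (nome τ ^ p) (nome τ ^ p) ^ p / qPoch (nome τ) (nome τ)) =
      ∏ a ∈ S, diamond 1 (γ a) (eisensteinMean p) τ := by
  have hinv : ∀ a ∈ S, ((invIndex p a : ℤ) : ZMod p) * (a : ZMod p) = 1 := by
    intro a ha
    have ha0 : (a : ZMod p) ≠ 0 := by
      rw [Ne, ZMod.natCast_eq_zero_iff]; exact hcop a ha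
    rw [invIndex, Int.cast_natCast, ZMod.natCast_mod, Nat.cast_pow, ← pow_succ,
      show p - 2 + 1 = p - 1 by omega, ZMod.pow_card_sub_one_eq_one ha0]
  have hnd : ∀ a ∈ S, ¬ (p : ℤ) ∣ invIndex p a := by
    intro a ha hdvd
    rw [← ZMod.intCast_zmod_eq_zero_iff_dvd] at hdvd
    have := hinv a ha
    rw [hdvd, zero_mul] at this
    exact zero_ne_one this
  -- As p divides γ₂₁, the determinant gives γ₁₁ a ≡ 1, so γ₁₁ may be replaced by the inverse
  -- `invIndex p a`.
  have hterm : ∀ a ∈ S, diamond 1 (γ a) (eisensteinMean p) τ = _ := fun a ha => by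
    rw [diamond_eisensteinMean hb hp2, sum_zetaQ_congr τ hb (hnd a ha) ?_,
      sum_zetaQ_eq τ hb (hnd a ha) hb12]
    set g : SL(2, ℤ) := (γ a : SL(2, ℤ)) with hg
    have hdet : g 0 0 * g 1 1 - g 0 1 * g 1 0 = 1 := by
      have := g.det_coe
      rwa [Matrix.det_fin_two] at this
    have h10 : ((g 1 0 : ℤ) : ZMod p) = 0 := CongruenceSubgroup.Gamma0_mem.1 (γ a).2
    have h11 : ((g 1 1 : ℤ) : ZMod p) = a := hγ a ha
    have hdet' := congrArg (Int.cast : ℤ → ZMod p) hdet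
    push_cast at hdet'
    rw [h10, h11, mul_zero, sub_zero] at hdet'
    have ha0 : (a : ZMod p) ≠ 0 := right_ne_zero_of_mul (by rw [hdet']; exact one_ne_zero)
    rw [← ZMod.intCast_zmod_eq_zero_iff_dvd, Int.cast_sub, sub_eq_zero]
    exact mul_right_cancel₀ ha0 (hdet'.trans (hinv a ha).symm)
  simp only [List.mem_cons, List.not_mem_nil, or_false, forall_eq_or_imp, forall_eq] at himage
  obtain ⟨i1, i2, i3, i4, i5, i6, i7⟩ := himage
  simp only [List.map_cons, List.map_nil, List.prod_cons, List.prod_nil, mul_one] at hsign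
  have hP := prod_thetaInt_Icc τ hph he
  have hq : ‖nome τ‖ < 1 := norm_expo_lt_one τ.im_pos
  have hE0 := qPoch_self_ne_zero hq
  have hQ0 : qPoch (nome τ ^ p) (nome τ ^ p) ≠ 0 := qPoch_self_ne_zero (by
    rw [norm_pow]; exact pow_lt_one₀ (norm_nonneg _) hq hp.out.ne_zero)
  have hsgn0 : ∀ c, ((∏ a ∈ S, residueSign p (invIndex p a * c) : ℤ) : ℂ) ≠ 0 := by
    intro c
    rw [Int.cast_ne_zero, Finset.prod_ne_zero_iff]
    intro a _
    rw [residueSign]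
    split_ifs <;> norm_num
  rw [Finset.prod_congr rfl hterm, Finset.prod_div_distrib]
  simp only [Finset.prod_mul_distrib, Finset.prod_const, hcard]
  -- Each of the seven products over S becomes a sign times the same P; P³/P⁴ leaves 1/P, and
  -- `hsign` cancels the signs.
  rw [prod_thetaInt τ hcard i1, prod_thetaInt τ hcard i2, prod_thetaInt τ hcard i3,
    prod_thetaInt τ hcard i4, prod_thetaInt τ hcard i5, prod_thetaInt τ hcard i6,
    prod_thetaInt τ hcard i7]
  have hsign' := congrArg (Int.cast : ℤ → ℂ) hsign
  simp only [Int.cast_mul] at hsign'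
  have s4 := hsgn0 (b 0)
  have s5 := hsgn0 (b 1)
  have s6 := hsgn0 (b 2)
  have s7 := hsgn0 (b 0 + b 1 + b 2)
  revert hsign' s4 s5 s6 s7
  generalize ((∏ a ∈ S, residueSign p (invIndex p a * (b 1 + b 2)) : ℤ) : ℂ) = c1
  generalize ((∏ a ∈ S, residueSign p (invIndex p a * (b 0 + b 1)) : ℤ) : ℂ) = c2
  generalize ((∏ a ∈ S, residueSign p (invIndex p a * (b 0 + b 2)) : ℤ) : ℂ) = c3
  generalize ((∏ a ∈ S, residueSign p (invIndex p a * b 0) : ℤ) : ℂ) = c4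
  generalize ((∏ a ∈ S, residueSign p (invIndex p a * b 1) : ℤ) : ℂ) = c5
  generalize ((∏ a ∈ S, residueSign p (invIndex p a * b 2) : ℤ) : ℂ) = c6
  generalize ((∏ a ∈ S, residueSign p (invIndex p a * (b 0 + b 1 + b 2)) : ℤ) : ℂ) = c7
  intro hsign' s4 s5 s6 s7
  have hpow : qPoch (nome τ ^ p) (nome τ ^ p) ^ p = (qPoch (nome τ ^ p) (nome τ ^ p) ^ 2) ^ h *
      qPoch (nome τ ^ p) (nome τ ^ p) := by
    rw [← pow_mul, ← pow_succ, ← hph]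
  have hP0 : ∏ j ∈ Finset.Icc (1 : ℤ) h, thetaInt p τ j ≠ 0 := by
    intro h0
    rw [h0, mul_zero, mul_zero] at hP
    exact hE0 hP.symm
  rw [hpow]
  generalize ∏ j ∈ Finset.Icc (1 : ℤ) h, thetaInt p τ j = P at hP hP0 ⊢
  generalize qPoch (nome τ ^ p) (nome τ ^ p) = Q at hP hQ0 ⊢
  generalize qPoch (nome τ) (nome τ) = E at hP hE0 ⊢
  rw [← mul_div_assoc, div_eq_div_iff hE0 (by simp [s4, s5, s6, s7, hP0])]
  rw [← hP]
  linear_combination -(nome τ ^ e * (Q ^ 2) ^ h * Q * P ^ 4) * hsign'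

end
end PCore

end

/-! ### Balanced quadruples for the primes from 5 to 19 -/

noncomputable section
namespace PCore

theorem eisensteinMean_product (p : ℕ) [Fact p.Prime] (hp5 : 5 ≤ p) (hp19 : p ≤ 19)
    (γ : ℕ → CongruenceSubgroup.Gamma0 p)
    (hγ : ∀ a ∈ genIndices p, Represents (γ a) a) (τ : UpperHalfPlane) :
    nome τ ^ ((p ^ 2 - 1) / 24) *
        (qPoch (nome τ ^ p) (nome τ ^ p) ^ p / qPoch (nome τ) (nome τ)) =
      ∏ a ∈ genIndices p, diamond 1 (γ a) (eisensteinMean p) τ := by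
  have hpp : p.Prime := Fact.out
  obtain ⟨b, h, hb, hp2, hb12, hcop, hcard, hph, he, himage, hsign⟩ :
      ∃ (b : Fin 4 → ℤ) (h : ℕ), IsBalanced p b ∧ 2 < p ∧ ¬ (p : ℤ) ∣ b 1 - b 2 ∧
      (∀ a ∈ genIndices p, ¬ p ∣ a) ∧ (genIndices p).card = h ∧ p = 2 * h + 1 ∧
      ∑ j ∈ Finset.Icc (1 : ℤ) h, j * (p - j) = 2 * p * ((p ^ 2 - 1) / 24 : ℕ) ∧
      (∀ c ∈ [b 1 + b 2, b 0 + b 1, b 0 + b 2, b 0, b 1, b 2, b 0 + b 1 + b 2],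
        (genIndices p).image (fun a => absResidue p (invIndex p a * c)) =
          Finset.Icc (1 : ℤ) h) ∧
      ([b 1 + b 2, b 0 + b 1, b 0 + b 2].map fun c =>
          ∏ a ∈ genIndices p, residueSign p (invIndex p a * c)).prod =
        ([b 0, b 1, b 2, b 0 + b 1 + b 2].map fun c =>
          ∏ a ∈ genIndices p, residueSign p (invIndex p a * c)).prod := by
    clear hγ γ
    interval_cases p
    -- All conditions are decidable for a given p. The repeated entry stands in the positions 0 and
    -- 1, because b 1 and b 2 must differ modulo p. The exponent (p² - 1)/24 is ∑ j(p - j)/(2p) over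
    -- 1 ≤ j ≤ h.
    · exact ⟨![1, 1, 2, -4], 2, ⟨by decide, by decide, by decide, by decide +kernel⟩,
        by decide +kernel⟩
    · norm_num at hpp
    · exact ⟨![1, 1, 2, -4], 3, ⟨by decide, by decide, by decide, by decide +kernel⟩,
        by decide +kernel⟩
    · norm_num at hpp
    · norm_num at hpp
    · norm_num at hpp
    · exact ⟨![1, 2, 3, -6], 5, ⟨by decide, by decide, by decide, by decide +kernel⟩,
        by decide +kernel⟩
    · norm_num at hpp
    · exact ⟨![1, 3, 4, -8], 6, ⟨by decide, by decide, by decide, by decide +kernel⟩,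
        by decide +kernel⟩
    · norm_num at hpp
    · norm_num at hpp
    · norm_num at hpp
    · exact ⟨![2, 3, 5, -10], 8, ⟨by decide, by decide, by decide, by decide +kernel⟩,
        by decide +kernel⟩
    · norm_num at hpp
    · exact ⟨![3, 4, 5, -12], 9, ⟨by decide, by decide, by decide, by decide +kernel⟩,
        by decide +kernel⟩
  exact prod_diamond_eisensteinMean τ hb hp2 hb12 hcop hcard hph he himage hsign γ hγ

end PCore
end

/-! ### Euler's generating function of partitions -/

noncomputable section
namespace PCore
open Filter Topology Set

/-- Induction on the number of factors; absolute convergence is carried along because the product of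
two series needs it. -/
theorem hasSum_fin_prod {𝕜 α : Type*} [RCLike 𝕜] (n : ℕ) (f : Fin n → α → 𝕜)
    (hf : ∀ i, Summable fun a => ‖f i a‖) :
    (Summable fun x : Fin n → α => ‖∏ i, f i (x i)‖) ∧
    HasSum (fun x : Fin n → α => ∏ i, f i (x i)) (∏ i, ∑' a, f i a) := by
  induction n with
  | zero =>
    have h : HasSum (fun x : Fin 0 → α => ∏ i, f i (x i)) (∏ i, ∑' a, f i a) := by
      simp
    exact ⟨h.summable.norm, h⟩
  | succ n ih =>
    obtain ⟨h1, h2⟩ := ih (fun i => f i.succ) fun i => hf i.succ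
    let g : (Fin n → α) → 𝕜 := fun y => ∏ i : Fin n, f i.succ (y i)
    have hs : Summable fun x : α × (Fin n → α) => ‖f 0 x.1 * g x.2‖ :=
      Summable.mul_norm (f := f 0) (g := g) (hf 0) h1
    let e : α × (Fin n → α) ≃ (Fin (n + 1) → α) := Fin.consEquiv fun _ => α
    have he : (fun x : Fin (n + 1) → α => ∏ i, f i (x i)) ∘ e = fun x => f 0 x.1 * g x.2 := by
      funext x
      exact Fin.prod_univ_succ _
    have h3 : HasSum (fun x : α × (Fin n → α) => f 0 x.1 * g x.2)
        ((∑' a, f 0 a) * ∏ i : Fin n, ∑' a, f i.succ a) :=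
      HasSum.mul (hf 0).of_norm.hasSum h2 hs.of_norm
    constructor
    · rw [← e.summable_iff]
      exact hs.congr fun x => congrArg norm (congrFun he x).symm
    · rw [← e.hasSum_iff, Fin.prod_univ_succ, he]
      exact h3

/-- The Young diagram with the row lengths `l`. -/
def ofRowLen (l : ℕ → ℕ) (hl : Antitone l) (K : ℕ) : YoungDiagram where
  cells := (Finset.range K ×ˢ Finset.range (l 0)).filter fun c => c.2 < l c.1
  isLowerSet := by
    rintro ⟨i, j⟩ ⟨i', j'⟩ ⟨hi, hj⟩ h
    simp only [Finset.coe_filter, Finset.mem_product, Finset.mem_range, mem_ofPred_eq] at h hi hj ⊢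
    have := hl hi
    omega

theorem rowLen_ofRowLen {l : ℕ → ℕ} (hl : Antitone l) {K : ℕ} (hK : l K = 0) (i : ℕ) :
    (ofRowLen l hl K).rowLen i = l i := by
  have h : ∀ j, j < (ofRowLen l hl K).rowLen i ↔ j < l i := by
    intro j
    rw [← YoungDiagram.mem_iff_lt_rowLen, ← YoungDiagram.mem_cells, ofRowLen]
    simp only [Finset.mem_filter, Finset.mem_product, Finset.mem_range]
    refine ⟨fun h => h.2, fun h => ⟨⟨?_, h.trans_le (hl (Nat.zero_le i))⟩, h⟩⟩
    by_contra! hi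
    have := hl hi
    omega
  exact le_antisymm (le_of_forall_lt fun j hj => (h j).1 hj)
    (le_of_forall_lt fun j hj => (h j).2 hj)

theorem eq_of_rowLen_eq {μ ν : YoungDiagram} (h : ∀ i, μ.rowLen i = ν.rowLen i) : μ = ν := by
  ext ⟨i, j⟩
  rw [YoungDiagram.mem_cells, YoungDiagram.mem_cells, YoungDiagram.mem_iff_lt_rowLen,
    YoungDiagram.mem_iff_lt_rowLen, h]

theorem card_eq_sum_rowLen (μ : YoungDiagram) {K : ℕ} (hK : μ.rowLen K = 0) :
    μ.card = ∑ i ∈ Finset.range K, μ.rowLen i := by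
  have h : ∀ c ∈ μ.cells, c.1 ∈ Finset.range K := by
    rintro ⟨i, j⟩ hc
    rw [YoungDiagram.mem_cells, YoungDiagram.mem_iff_lt_rowLen] at hc
    rw [Finset.mem_range]
    by_contra! hi
    have := μ.rowLen_anti _ _ hi
    simp only at this
    omega
  rw [YoungDiagram.card, Finset.card_eq_sum_card_fiberwise h]
  exact Finset.sum_congr rfl fun i _ => by rw [YoungDiagram.rowLen_eq_card, YoungDiagram.row]

theorem exists_rowLen_eq_zero (μ : YoungDiagram) : ∃ K, ∀ i, K ≤ i → μ.rowLen i = 0 := by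
  refine ⟨μ.colLen 0, fun i hi => ?_⟩
  by_contra h
  have := YoungDiagram.mem_iff_lt_rowLen.2 (Nat.pos_of_ne_zero h)
  rw [YoungDiagram.mem_iff_lt_colLen] at this
  omega

/-- The row lengths of the Young diagram with `d j` columns of length `j + 1` for `j < K`. -/
def rowLenOfColumns {K : ℕ} (d : Fin K → ℕ) (i : ℕ) : ℕ := ∑ j : Fin K, if i ≤ j then d j else 0

theorem antitone_rowLenOfColumns {K : ℕ} (d : Fin K → ℕ) : Antitone (rowLenOfColumns d) := by
  intro i i' h
  refine Finset.sum_le_sum fun j _ => ?_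
  split_ifs <;> omega

theorem rowLenOfColumns_self {K : ℕ} (d : Fin K → ℕ) : rowLenOfColumns d K = 0 :=
  Finset.sum_eq_zero fun j _ => if_neg (by omega)

theorem rowLenOfColumns_eq {K : ℕ} (d : Fin K → ℕ) (j : Fin K) :
    rowLenOfColumns d j = d j + rowLenOfColumns d (j + 1) := by
  have h : d j = ∑ i : Fin K, if i = j then d i else 0 := by simp
  rw [rowLenOfColumns, h, rowLenOfColumns, ← Finset.sum_add_distrib]
  refine Finset.sum_congr rfl fun i _ => ?_
  rcases lt_trichotomy i j with h | h | h
  · have := Fin.lt_def.1 h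
    rw [if_neg (by omega), if_neg h.ne, if_neg (by omega)]
  · subst h
    simp
  · have := Fin.lt_def.1 h
    rw [if_pos (by omega), if_neg h.ne', if_pos (by omega), zero_add]

/-- The Young diagram with `d j` columns of length `j + 1` for `j < K`. -/
def ofColumns {K : ℕ} (d : Fin K → ℕ) : YoungDiagram :=
  ofRowLen (rowLenOfColumns d) (antitone_rowLenOfColumns d) K

theorem rowLen_ofColumns {K : ℕ} (d : Fin K → ℕ) (i : ℕ) :
    (ofColumns d).rowLen i = rowLenOfColumns d i := rowLen_ofRowLen _ (rowLenOfColumns_self d) i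

theorem injective_ofColumns (K : ℕ) : Function.Injective (ofColumns (K := K)) := by
  intro d d' h
  funext j
  have e : ∀ i, rowLenOfColumns d i = rowLenOfColumns d' i := fun i => by
    rw [← rowLen_ofColumns, h, rowLen_ofColumns]
  have h1 := rowLenOfColumns_eq d j
  have h2 := rowLenOfColumns_eq d' j
  rw [e, e] at h1
  omega

theorem mem_range_ofColumns {K : ℕ} {μ : YoungDiagram} (h : μ.rowLen K = 0) :
    μ ∈ range (ofColumns (K := K)) := by
  refine ⟨fun j => μ.rowLen j - μ.rowLen (j + 1), eq_of_rowLen_eq fun i => ?_⟩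
  rw [rowLen_ofColumns]
  set d : Fin K → ℕ := fun j => μ.rowLen j - μ.rowLen (j + 1) with hd
  rcases le_total K i with hi | hi
  · have h1 := antitone_rowLenOfColumns d hi
    have h2 := μ.rowLen_anti _ _ hi
    rw [rowLenOfColumns_self] at h1
    omega
  · induction hi using Nat.decreasingInduction with
    | self => rw [h, rowLenOfColumns_self]
    | of_succ i hi ih =>
      have h1 := rowLenOfColumns_eq d ⟨i, hi⟩
      have h2 := μ.rowLen_anti i (i + 1) (Nat.le_succ i)
      simp only [hd] at h1 ih ⊢
      rw [h1, ih]
      omega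

theorem card_ofColumns {K : ℕ} (d : Fin K → ℕ) :
    (ofColumns d).card = ∑ j : Fin K, (j + 1) * d j := by
  rw [card_eq_sum_rowLen _ (by rw [rowLen_ofColumns, rowLenOfColumns_self] : _ = 0)]
  simp only [rowLen_ofColumns, rowLenOfColumns]
  rw [Finset.sum_comm]
  refine Finset.sum_congr rfl fun j _ => ?_
  rw [← Finset.sum_filter, Finset.sum_const, smul_eq_mul]
  congr 1
  have : (Finset.range K).filter (fun i => i ≤ (j : ℕ)) = Finset.range (j + 1) := by
    ext i
    simp only [Finset.mem_filter, Finset.mem_range]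
    omega
  rw [this, Finset.card_range]

/-- A diagram with at most K rows is determined by the number of its columns of each length 1, …, K,
so the sum is a product of K geometric series. -/
theorem hasSum_pow_card_of_rowLen {𝕜 : Type*} [RCLike 𝕜] {q : 𝕜} (hq : ‖q‖ < 1) (K : ℕ) :
    HasSum (fun μ : YoungDiagram => if μ.rowLen K = 0 then q ^ μ.card else 0)
      (∏ j ∈ Finset.range K, (1 - q * q ^ j)⁻¹) := by
  have hn : ∀ j : Fin K, ‖q ^ (j + 1 : ℕ)‖ < 1 := fun j => by
    rw [norm_pow]; exact pow_lt_one₀ (norm_nonneg _) hq (Nat.succ_ne_zero _)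
  have h := (hasSum_fin_prod K (fun (j : Fin K) (n : ℕ) => (q ^ (j + 1 : ℕ)) ^ n)
    fun j => by
      simp only [norm_pow]
      exact summable_geometric_of_lt_one (by positivity) (by simpa using hn j)).2
  rw [← (injective_ofColumns K).hasSum_iff]
  · convert h using 1
    · funext d
      rw [Function.comp, if_pos (by rw [rowLen_ofColumns, rowLenOfColumns_self]), card_ofColumns,
        ← Finset.prod_pow_eq_pow_sum]
      exact Finset.prod_congr rfl fun j _ => by rw [pow_mul]
    · rw [Finset.prod_range]
      exact Finset.prod_congr rfl fun j _ => by
        rw [tsum_geometric_of_norm_lt_one (hn j), pow_succ']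
  · intro μ hμ
    exact if_neg fun h => hμ (mem_range_ofColumns h)

/-- Euler's generating function of the partitions, counted as Young diagrams. -/
theorem hasSum_pow_card {q : ℂ} (hq : ‖q‖ < 1) :
    (Summable fun μ : YoungDiagram => ‖q ^ μ.card‖) ∧
    HasSum (fun μ : YoungDiagram => q ^ μ.card) (qPoch q q)⁻¹ := by
  have lim : ∀ {q : ℂ}, ‖q‖ < 1 →
      Tendsto (fun K => ∏ j ∈ Finset.range K, (1 - q * q ^ j)⁻¹) atTop (𝓝 (qPoch q q)⁻¹) := by
    intro q hq
    simp only [Finset.prod_inv_distrib]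
    exact (multipliable_qPoch q q hq).hasProd.tendsto_prod_nat.inv₀ (qPoch_self_ne_zero hq)
  have hr : ‖(‖q‖ : ℂ)‖ < 1 := by simpa using hq
  have hrr : ‖‖q‖‖ < 1 := by simpa using hq
  -- Finitely many diagrams have at most K rows for a common K, so a finite sum of norms is at most
  -- a partial product at the real point ‖q‖; these products converge and are bounded.
  have hsum : Summable fun μ : YoungDiagram => ‖q ^ μ.card‖ := by
    obtain ⟨C, hC⟩ := (lim hr).norm.bddAbove_range
    refine summable_of_sum_le (c := C) (fun _ => norm_nonneg _) fun s => ?_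
    choose N hN using exists_rowLen_eq_zero
    let K := s.sup N
    have h := hasSum_pow_card_of_rowLen hrr K
    calc ∑ μ ∈ s, ‖q ^ μ.card‖ = ∑ μ ∈ s, if μ.rowLen K = 0 then ‖q‖ ^ μ.card else 0 :=
          Finset.sum_congr rfl fun μ hμ => by
            rw [if_pos (hN μ K (Finset.le_sup (f := N) hμ)), norm_pow]
      _ ≤ ∏ j ∈ Finset.range K, (1 - ‖q‖ * ‖q‖ ^ j)⁻¹ :=
          sum_le_hasSum s (fun μ _ => by split_ifs <;> positivity) h
      _ ≤ ‖∏ j ∈ Finset.range K, (1 - (‖q‖ : ℂ) * (‖q‖ : ℂ) ^ j)⁻¹‖ := by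
          have e : ∏ j ∈ Finset.range K, (1 - (‖q‖ : ℂ) * (‖q‖ : ℂ) ^ j)⁻¹ =
              ((∏ j ∈ Finset.range K, (1 - ‖q‖ * ‖q‖ ^ j)⁻¹ : ℝ) : ℂ) := by push_cast; rfl
          rw [e, Complex.norm_real]
          exact le_abs_self _
      _ ≤ C := hC ⟨K, rfl⟩
  refine ⟨hsum, ?_⟩
  have h1 : Tendsto (fun K => ∑' μ : YoungDiagram, if μ.rowLen K = 0 then q ^ μ.card else 0) atTop
      (𝓝 (∑' μ : YoungDiagram, q ^ μ.card)) := by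
    refine tendsto_tsum_of_dominated_convergence hsum (fun μ => ?_) (.of_forall fun K μ => ?_)
    · obtain ⟨N, hN⟩ := exists_rowLen_eq_zero μ
      refine tendsto_const_nhds.congr' ?_
      filter_upwards [eventually_ge_atTop N] with K hK
      rw [if_pos (hN K hK)]
    · split_ifs
      · exact le_rfl
      · rw [norm_zero]; exact norm_nonneg _
  simp only [(hasSum_pow_card_of_rowLen hq _).tsum_eq] at h1
  rw [tendsto_nhds_unique (lim hq) h1]
  exact hsum.of_norm.hasSum

end PCore

end

/-! ### Maya diagrams and hook numbers -/

noncomputable section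
namespace PCore
open Filter Topology Set

/-- The Maya diagram of charge `n` of a Young diagram. -/
def maya (μ : YoungDiagram) (n : ℤ) : Set ℤ := range fun i : ℕ => (μ.rowLen i : ℤ) - 1 - i + n

/-- A set of integers that contains all sufficiently small and no sufficiently large integers. -/
def IsMaya (M : Set ℤ) : Prop := ∃ a b : ℤ, (∀ x < a, x ∈ M) ∧ ∀ x, b ≤ x → x ∉ M

open scoped Classical in
/-- The sum of `w` over `M`, relative to the sum of `w` over the negative integers. -/
def mayaSum (w : ℤ → ℤ) (M : Set ℤ) : ℤ :=
  ∑ᶠ x, w x * ((if x ∈ M then 1 else 0) - if x < 0 then 1 else 0)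

/-- This makes `mayaSum` a genuine sum: `finsum` is 0 by convention on infinite supports. -/
theorem IsMaya.finite_support {M : Set ℤ} (hM : IsMaya M) (w : ℤ → ℤ) [DecidablePred (· ∈ M)] :
    (Function.support fun x => w x * ((if x ∈ M then 1 else 0) - if x < 0 then 1 else
      0)).Finite := by
  obtain ⟨a, b, ha, hb⟩ := hM
  refine (Set.finite_Icc (min a 0) (max b 0)).subset fun x hx => ?_
  rw [Function.mem_support] at hx
  by_contra h
  rw [mem_Icc, not_and_or, not_le, not_le] at h
  apply hx
  rcases h with h | h
  · rw [if_pos (ha x (by omega)), if_pos (by omega), sub_self, mul_zero]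
  · rw [if_neg (hb x (by omega)), if_neg (by omega), sub_self, mul_zero]

/-- Below the cutoff -L the set and the negative integers agree, so only two finite sums remain. -/
theorem mayaSum_eq {M : Set ℤ} (F : Finset ℤ) (L : ℕ) (hF : ∀ x ∈ F, -(L : ℤ) ≤ x)
    (hM : ∀ x, x ∈ M ↔ x ∈ F ∨ x < -(L : ℤ)) (w : ℤ → ℤ) :
    mayaSum w M = ∑ x ∈ F, w x - ∑ x ∈ Finset.Ico (-(L : ℤ)) 0, w x := by
  classical
  have h : ∀ x, w x * ((if x ∈ M then 1 else 0) - if x < 0 then 1 else 0) =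
      (if x ∈ F then w x else 0) - if x ∈ Finset.Ico (-(L : ℤ)) 0 then w x else 0 := by
    intro x
    have h1 := hM x
    have h2 := hF x
    simp only [Finset.mem_Ico]
    by_cases hx : x ∈ F
    · have := h2 hx
      rw [if_pos (h1.2 (.inl hx)), if_pos hx]
      by_cases h0 : x < 0
      · rw [if_pos h0, if_pos ⟨this, h0⟩]; ring
      · rw [if_neg h0, if_neg fun h => h0 h.2]; ring
    · by_cases h3 : x < -(L : ℤ)
      · rw [if_pos (h1.2 (.inr h3)), if_neg hx, if_pos (by omega), if_neg (by omega)]; ring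
      · rw [if_neg fun h => (h1.1 h).elim hx h3, if_neg hx]
        by_cases h0 : x < 0
        · rw [if_pos h0, if_pos ⟨by omega, h0⟩]; ring
        · rw [if_neg h0, if_neg fun h => h0 h.2]; ring
  rw [mayaSum]
  simp only [h]
  rw [finsum_eq_sum_of_support_subset (s := F ∪ Finset.Ico (-(L : ℤ)) 0), Finset.sum_sub_distrib]
  · congr 1
    · rw [Finset.sum_ite_mem, Finset.inter_eq_right.2 Finset.subset_union_left]
    · rw [Finset.sum_ite_mem, Finset.inter_eq_right.2 Finset.subset_union_right]
  · intro x hx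
    rw [Function.mem_support] at hx
    by_contra hx'
    rw [Finset.mem_coe, Finset.mem_union, not_or] at hx'
    exact hx (by rw [if_neg hx'.1, if_neg hx'.2, sub_self])

theorem two_mul_sum_Ico_neg (L : ℕ) :
    2 * ∑ x ∈ Finset.Ico (-(L : ℤ)) 0, x = -((L : ℤ) * (L + 1)) := by
  induction L with
  | zero => simp
  | succ L ih =>
    have : Finset.Ico (-((L + 1 : ℕ) : ℤ)) 0 =
        insert (-((L + 1 : ℕ) : ℤ)) (Finset.Ico (-(L : ℤ)) 0) := by
      ext x
      simp only [Finset.mem_Ico, Finset.mem_insert]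
      omega
    rw [this, Finset.sum_insert (by simp), mul_add, ih]
    push_cast
    ring

theorem strictAnti_maya (μ : YoungDiagram) (n : ℤ) :
    StrictAnti fun i : ℕ => (μ.rowLen i : ℤ) - 1 - i + n := by
  refine strictAnti_nat_of_succ_lt fun i => ?_
  have := μ.rowLen_anti i (i + 1) (Nat.le_succ i)
  push_cast
  omega

theorem exists_maya_eq (μ : YoungDiagram) (n : ℤ) : ∃ (F : Finset ℤ) (K L : ℕ), (L : ℤ) = K - n ∧
    μ.rowLen K = 0 ∧ F = (Finset.range K).image (fun i : ℕ => (μ.rowLen i : ℤ) - 1 - i + n) ∧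
    (∀ x ∈ F, -(L : ℤ) ≤ x) ∧ ∀ x, x ∈ maya μ n ↔ x ∈ F ∨ x < -(L : ℤ) := by
  obtain ⟨N, hN⟩ := exists_rowLen_eq_zero μ
  have hL : (((max N n.natAbs : ℕ) - n).toNat : ℤ) = (max N n.natAbs : ℕ) - n :=
    Int.toNat_of_nonneg (by omega)
  -- K ≥ |n| keeps L = K - n nonnegative. The rows from K on are empty and fill exactly the integers
  -- below -L.
  refine ⟨_, max N n.natAbs, ((max N n.natAbs : ℕ) - n).toNat, hL, hN _ (le_max_left _ _), rfl,
    ?_, ?_⟩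
  · intro x hx
    obtain ⟨i, hi, rfl⟩ := Finset.mem_image.1 hx
    rw [Finset.mem_range] at hi
    omega
  · intro x
    rw [hL, Finset.mem_image]
    constructor
    · rintro ⟨i, rfl⟩
      by_cases hi : i < max N n.natAbs
      · exact .inl ⟨i, Finset.mem_range.2 hi, rfl⟩
      · right
        have := hN i (by omega)
        simp only [this]
        omega
    · rintro (⟨i, -, rfl⟩ | h)
      · exact ⟨i, rfl⟩
      · refine ⟨(n - 1 - x).toNat, ?_⟩
        have := hN (n - 1 - x).toNat (by omega)
        simp only [this]
        omega

theorem isMaya_maya (μ : YoungDiagram) (n : ℤ) : IsMaya (maya μ n) := by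
  obtain ⟨F, K, L, -, -, -, -, h⟩ := exists_maya_eq μ n
  refine ⟨-L, μ.rowLen 0 + n, fun x hx => (h x).2 (.inr hx), ?_⟩
  rintro x hx ⟨i, rfl⟩
  have := μ.rowLen_anti 0 i (Nat.zero_le i)
  simp only at hx
  omega

theorem mayaSum_one_maya (μ : YoungDiagram) (n : ℤ) : mayaSum (fun _ => 1) (maya μ n) = n := by
  obtain ⟨F, K, L, hL, -, rfl, hF, h⟩ := exists_maya_eq μ n
  rw [mayaSum_eq _ L hF h, Finset.sum_image (strictAnti_maya μ n).injective.injOn]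
  simp only [Finset.sum_const, Finset.card_range, Int.card_Ico, nsmul_eq_mul, mul_one]
  omega

theorem two_mul_mayaSum_id_maya (μ : YoungDiagram) (n : ℤ) :
    2 * mayaSum (fun x => x) (maya μ n) = 2 * μ.card + n * (n - 1) := by
  obtain ⟨F, K, L, hL, hK, rfl, hF, h⟩ := exists_maya_eq μ n
  have e : ∀ K : ℕ, 2 * ∑ i ∈ Finset.range K, ((μ.rowLen i : ℤ) - 1 - i + n) =
      2 * ∑ i ∈ Finset.range K, (μ.rowLen i : ℤ) - K * (K + 1) + 2 * K * n := by
    intro K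
    induction K with
    | zero => simp
    | succ K ih =>
      rw [Finset.sum_range_succ, Finset.sum_range_succ, mul_add, ih]
      push_cast
      ring
  rw [mayaSum_eq _ L hF h, Finset.sum_image (strictAnti_maya μ n).injective.injOn, mul_sub, e,
    two_mul_sum_Ico_neg, hL, card_eq_sum_rowLen μ hK]
  push_cast
  ring

/-- The charge is recovered as the relative number of elements; then two strictly decreasing
sequences with the same range agree. -/
theorem maya_injective {μ ν : YoungDiagram} {m n : ℤ} (h : maya μ m = maya ν n) :
    m = n ∧ μ = ν := by
  have e : m = n := by rw [← mayaSum_one_maya μ m, h, mayaSum_one_maya]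
  subst e
  refine ⟨rfl, eq_of_rowLen_eq fun i => ?_⟩
  have h1 : range (fun i : ℕ => -((μ.rowLen i : ℤ) - 1 - i + m)) =
      range (fun i : ℕ => -((ν.rowLen i : ℤ) - 1 - i + m)) := by
    have := congrArg (fun A : Set ℤ => Neg.neg '' A) h
    simpa only [maya, ← range_comp, Function.comp_def] using this
  have h2 := congrFun (((strictAnti_maya μ m).neg.range_inj (strictAnti_maya ν m).neg).1 h1) i
  omega

theorem IsMaya.exists_maya {M : Set ℤ} (hM : IsMaya M) : ∃ μ n, maya μ n = M := by
  obtain ⟨a, b, ha, hb⟩ := hM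
  let S : ℕ → Prop := fun k => b - 1 - k ∈ M
  let N : ℕ := (b - a).toNat
  have hS : ∀ k, N ≤ k → S k := fun k hk => ha _ (by omega)
  have hinf : ({k | S k}).Infinite := infinite_of_not_bddAbove fun ⟨B, hB⟩ => by
    have := hB (hS (max N (B + 1)) (le_max_left _ _))
    omega
  have hmono : StrictMono (Nat.nth S) := Nat.nth_strictMono hinf
  have hrange : range (Nat.nth S) = {k | S k} := Nat.range_nth_of_infinite hinf
  have hlow : ∀ i, i ≤ Nat.nth S i := fun i => hmono.le_apply
  have hup : ∀ i, Nat.nth S i ≤ N + i := by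
    intro i
    by_contra! hi
    have hm : ∀ j, N + j ∈ range (Nat.nth S) := fun j => by
      rw [hrange]; exact hS _ (Nat.le_add_right _ _)
    induction i with
    | zero =>
      obtain ⟨k, hk⟩ := hm 0
      have := hmono.monotone (Nat.zero_le k)
      omega
    | succ i ih =>
      obtain ⟨k, hk⟩ := hm (i + 1)
      have h1 : k < i + 1 := hmono.lt_iff_lt.1 (by omega)
      have h2 := hmono.monotone (Nat.lt_succ_iff.1 h1)
      exact ih (by omega)
  -- The number of gaps above the i-th largest element, counted below b. It is nondecreasing and
  -- bounded; with its maximum d i₀, the row lengths are d i₀ - d i and the charge is b - d i₀.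
  let d : ℕ → ℕ := fun i => Nat.nth S i - i
  have hd : Monotone d := monotone_nat_of_le_succ fun i => by
    have := hmono (Nat.lt_add_one i)
    have := hlow i
    simp only [d]
    omega
  have hbdd : BddAbove (range d) := ⟨N, by
    rintro _ ⟨i, rfl⟩
    have := hup i
    simp only [d]
    omega⟩
  obtain ⟨i₀, hi₀⟩ := Nat.sSup_mem (range_nonempty d) hbdd
  have hmax : ∀ i, d i ≤ d i₀ := fun i => by rw [hi₀]; exact le_csSup hbdd ⟨i, rfl⟩
  have hl : Antitone fun i => d i₀ - d i := fun i j h => by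
    have := hd h
    simp only
    omega
  refine ⟨ofRowLen _ hl i₀, b - d i₀, ?_⟩
  have e : ∀ i : ℕ, ((ofRowLen _ hl i₀).rowLen i : ℤ) - 1 - i + (b - d i₀) =
      b - 1 - Nat.nth S i := by
    intro i
    rw [rowLen_ofRowLen hl (Nat.sub_self _)]
    have := hmax i
    have := hlow i
    simp only [d] at *
    omega
  rw [maya]
  simp only [e]
  ext x
  constructor
  · rintro ⟨i, rfl⟩
    exact Nat.nth_mem_of_infinite hinf i
  · intro hx
    have h1 : x < b := by
      by_contra! h
      exact hb x h hx
    have h2 : ((b - 1 - x).toNat : ℤ) = b - 1 - x := Int.toNat_of_nonneg (by omega)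
    have h3 : (b - 1 - x).toNat ∈ range (Nat.nth S) := by
      rw [hrange]
      change b - 1 - ((b - 1 - x).toNat : ℤ) ∈ M
      rwa [h2, sub_sub_cancel]
    obtain ⟨i, hi⟩ := h3
    exact ⟨i, by simp only [hi, h2]; ring⟩

/-! ### Cores -/

/-- In this form the hook number is the element of the Maya diagram given by row i minus the gap
given by column j. -/
theorem card_hook {μ : YoungDiagram} {i j : ℕ} (h : (i, j) ∈ μ) :
    ((hook μ (i, j)).card : ℤ) = ((μ.rowLen i : ℤ) - 1 - i) - (j - μ.colLen j) := by
  have h1 := YoungDiagram.mem_iff_lt_rowLen.1 h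
  have h2 := YoungDiagram.mem_iff_lt_colLen.1 h
  have e : hook μ (i, j) = (Finset.Ico j (μ.rowLen i)).image (fun k => (i, k)) ∪
      (Finset.Ico (i + 1) (μ.colLen j)).image (fun k => (k, j)) := by
    ext ⟨x, y⟩
    simp only [hook, Finset.mem_filter, YoungDiagram.mem_cells, Finset.mem_union, Finset.mem_image,
      Finset.mem_Ico, Prod.mk.injEq]
    constructor
    · rintro ⟨hm, ⟨rfl, hy⟩ | ⟨rfl, hx⟩⟩
      · exact .inl ⟨y, ⟨hy, YoungDiagram.mem_iff_lt_rowLen.1 hm⟩, rfl, rfl⟩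
      · rcases hx.eq_or_lt with rfl | hx
        · exact .inl ⟨y, ⟨le_rfl, h1⟩, rfl, rfl⟩
        · exact .inr ⟨x, ⟨hx, YoungDiagram.mem_iff_lt_colLen.1 hm⟩, rfl, rfl⟩
    · rintro (⟨k, ⟨h3, h4⟩, rfl, rfl⟩ | ⟨k, ⟨h3, h4⟩, rfl, rfl⟩)
      · exact ⟨YoungDiagram.mem_iff_lt_rowLen.2 h4, .inl ⟨rfl, h3⟩⟩
      · exact ⟨YoungDiagram.mem_iff_lt_colLen.2 h4, .inr ⟨rfl, by omega⟩⟩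
  rw [e, Finset.card_union_of_disjoint,
    Finset.card_image_of_injective _ (Prod.mk_right_injective i),
    Finset.card_image_of_injective _ (Prod.mk_left_injective j), Nat.card_Ico, Nat.card_Ico]
  · omega
  · rw [Finset.disjoint_left]
    intro c hc hc'
    obtain ⟨k, -, rfl⟩ := Finset.mem_image.1 hc
    obtain ⟨l, hl, h⟩ := Finset.mem_image.1 hc'
    rw [Prod.mk.injEq] at h
    rw [Finset.mem_Ico] at hl
    omega

theorem notMem_maya_iff (μ : YoungDiagram) (x : ℤ) :
    x ∉ maya μ 0 ↔ ∃ j : ℕ, x = j - μ.colLen j := by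
  constructor
  · intro hx
    have hex : ∃ i : ℕ, (μ.rowLen i : ℤ) - 1 - i < x := by
      refine ⟨(μ.rowLen 0 - x).toNat, ?_⟩
      have := μ.rowLen_anti 0 (μ.rowLen 0 - x).toNat (Nat.zero_le _)
      omega
    classical
    have h1 := Nat.find_spec hex
    -- If i is the first row whose element lies below x, the column of the gap x has length i, hence
    -- index x + i.
    refine ⟨(x + Nat.find hex).toNat, ?_⟩
    have h2 : μ.colLen (x + Nat.find hex).toNat = Nat.find hex := by
      refine le_antisymm ?_ ?_
      · by_contra! h
        rw [← YoungDiagram.mem_iff_lt_colLen, YoungDiagram.mem_iff_lt_rowLen] at h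
        omega
      · by_contra! h
        have h3 := Nat.find_min hex (m := Nat.find hex - 1) (by omega)
        have h4 : x ≠ μ.rowLen (Nat.find hex - 1) - 1 - (Nat.find hex - 1 : ℕ) :=
          fun e => hx ⟨_, by simp only [add_zero]; exact e.symm⟩
        have h5 : ¬ Nat.find hex - 1 < μ.colLen (x + Nat.find hex).toNat := by omega
        rw [← YoungDiagram.mem_iff_lt_colLen, YoungDiagram.mem_iff_lt_rowLen] at h5
        omega
    rw [h2]
    omega
  · rintro ⟨j, rfl⟩ ⟨i, hi⟩
    simp only at hi
    by_cases h : (i, j) ∈ μ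
    · have h1 := YoungDiagram.mem_iff_lt_rowLen.1 h
      have h2 := YoungDiagram.mem_iff_lt_colLen.1 h
      omega
    · have h1 := mt YoungDiagram.mem_iff_lt_rowLen.2 h
      have h2 := mt YoungDiagram.mem_iff_lt_colLen.2 h
      omega

/-- Hook numbers are the differences between an element and a smaller gap. A gap at x - t yields the
hook number t; conversely, closure under subtraction of t leaves no gap at any x - tk. -/
theorem isCore_iff {t : ℕ} (ht : 0 < t) (μ : YoungDiagram) :
    IsCore t μ ↔ ∀ x ∈ maya μ 0, x - t ∈ maya μ 0 := by
  constructor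
  · rintro h x ⟨i, rfl⟩
    by_contra hx
    obtain ⟨j, hj⟩ := (notMem_maya_iff μ _).1 hx
    have hc : (i, j) ∈ μ := by
      by_contra h
      have h1 := mt YoungDiagram.mem_iff_lt_rowLen.2 h
      have h2 := mt YoungDiagram.mem_iff_lt_colLen.2 h
      simp only at hj
      omega
    refine h (i, j) ((YoungDiagram.mem_cells _).2 hc) ?_
    have h3 := card_hook hc
    have : (hook μ (i, j)).card = t := by
      simp only at hj
      omega
    rw [this]
  · rintro h ⟨i, j⟩ hc ⟨k, hk⟩
    rw [YoungDiagram.mem_cells] at hc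
    have h1 := card_hook hc
    have h2 : ∀ k : ℕ, (μ.rowLen i : ℤ) - 1 - i - t * k ∈ maya μ 0 := by
      intro k
      induction k with
      | zero => exact ⟨i, by simp⟩
      | succ k ih =>
        have := h _ ih
        rwa [sub_sub, ← mul_add_one, ← Nat.cast_add_one] at this
    refine (notMem_maya_iff μ _).2 ⟨j, ?_⟩ (h2 k)
    rw [hk] at h1
    push_cast at h1
    linarith

theorem isCore_one_iff (μ : YoungDiagram) : IsCore 1 μ ↔ μ = ⊥ := by
  constructor
  · intro h
    ext c
    exact ⟨fun hc => (h c hc (one_dvd _)).elim, fun hc => (YoungDiagram.notMem_bot c hc).elim⟩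
  · rintro rfl c hc
    exact (YoungDiagram.notMem_bot c hc).elim

theorem mem_maya_iff (μ : YoungDiagram) (n x : ℤ) : x ∈ maya μ n ↔ x - n ∈ maya μ 0 := by
  simp only [maya, mem_range, add_zero, eq_sub_iff_add_eq]

/-- The case t = 1 of `isCore_iff`, shifted by the charge. -/
theorem maya_closed_iff (μ : YoungDiagram) (n : ℤ) :
    (∀ x ∈ maya μ n, x - 1 ∈ maya μ n) ↔ μ = ⊥ := by
  rw [← isCore_one_iff, isCore_iff one_pos]
  constructor
  · intro h x hx
    have := h (x + n) ((mem_maya_iff μ n _).2 (by rwa [add_sub_cancel_right]))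
    rw [mem_maya_iff] at this
    convert this using 1
    push_cast
    ring
  · intro h x hx
    rw [mem_maya_iff] at hx ⊢
    convert h _ hx using 1
    push_cast
    ring

end PCore

end

/-! ### The abacus and the generating function of cores -/

noncomputable section
namespace PCore
open Filter Topology Set

/-- The part of `M` in the residue class of `i`. -/
def splitMaya {p : ℕ} (M : Set ℤ) (i : Fin p) : Set ℤ := {m | m * p + i ∈ M}

theorem IsMaya.split {p : ℕ} [NeZero p] {M : Set ℤ} (hM : IsMaya M) (i : Fin p) :
    IsMaya (splitMaya M i) := by
  obtain ⟨a, b, ha, hb⟩ := hM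
  have hp : (1 : ℤ) ≤ p := by exact_mod_cast NeZero.one_le
  have hi : (i : ℤ) < p := by exact_mod_cast i.2
  refine ⟨min a 0 - 1, max b 0, fun x hx => ha _ ?_, fun x hx => hb _ ?_⟩
  · have h1 : x + 1 < a := by omega
    have h2 : x + 1 < 0 := by omega
    nlinarith
  · have h1 : b ≤ x := by omega
    have h2 : 0 ≤ x := by omega
    nlinarith

theorem mayaSum_split {p : ℕ} [NeZero p] {M : Set ℤ} (hM : IsMaya M) (w : ℤ → ℤ) :
    mayaSum w M = ∑ i : Fin p, mayaSum (fun m => w (m * p + i)) (splitMaya M i) := by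
  classical
  let e : Fin p × ℤ ≃ ℤ := (Equiv.prodComm _ _).trans (Int.divModEquiv p).symm
  have hs := hM.finite_support w
  rw [mayaSum, ← finsum_comp_equiv e, finsum_curry, finsum_eq_sum_of_fintype]
  · refine Finset.sum_congr rfl fun i _ => finsum_congr fun m => ?_
    change w (m * p + i) * ((if m * p + i ∈ M then 1 else 0) - if m * p + i < 0 then 1 else 0) = _
    -- As 0 ≤ i < p, the reference set of negative integers splits into p copies of itself.
    have h : (m * p + i < 0) ↔ m < 0 := by
      have hi : (i : ℤ) < p := by exact_mod_cast i.2
      constructor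
      · intro h
        by_contra! hm
        have : 0 ≤ m * p := by positivity
        omega
      · intro h
        have : m + 1 ≤ 0 := h
        nlinarith
    simp only [h]
    rfl
  · exact hs.preimage e.injective.injOn

theorem mayaSum_one_split {p : ℕ} [NeZero p] {M : Set ℤ} (hM : IsMaya M) :
    mayaSum (fun _ => 1) M = ∑ i : Fin p, mayaSum (fun _ => 1) (splitMaya M i) :=
  mayaSum_split hM _

theorem mayaSum_linear {M : Set ℤ} (hM : IsMaya M) (a b : ℤ) :
    mayaSum (fun x => x * a + b) M =
      mayaSum (fun x => x) M * a + b * mayaSum (fun _ => 1) M := by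
  classical
  rw [mayaSum, mayaSum, mayaSum, finsum_mul, mul_finsum, ← finsum_add_distrib]
  · exact finsum_congr fun x => by ring
  · refine (hM.finite_support fun x => x * a).subset fun x hx h => hx ?_
    simp only at h ⊢
    linear_combination h
  · refine (hM.finite_support fun x => b).subset fun x hx h => hx ?_
    simp only at h ⊢
    linear_combination h

theorem splitMaya_injective {p : ℕ} [NeZero p] :
    Function.Injective fun (M : Set ℤ) (i : Fin p) => splitMaya M i := by
  intro M N h
  ext x
  have h1 : splitMaya M (Int.divModEquiv p x).2 = splitMaya N (Int.divModEquiv p x).2 :=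
    congrFun h _
  have h2 : (Int.divModEquiv p x).1 ∈ splitMaya M (Int.divModEquiv p x).2 ↔
    (Int.divModEquiv p x).1 ∈ splitMaya N (Int.divModEquiv p x).2 := by rw [h1]
  have h3 : (Int.divModEquiv p x).1 * p + (Int.divModEquiv p x).2 = x :=
    (Int.divModEquiv p).symm_apply_apply x
  change _ * _ + _ ∈ M ↔ _ * _ + _ ∈ N at h2
  rwa [h3] at h2

theorem exists_splitMaya_eq {p : ℕ} [NeZero p] (N : Fin p → Set ℤ) (hN : ∀ i, IsMaya (N i)) :
    ∃ M, IsMaya M ∧ ∀ i, splitMaya M i = N i := by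
  have hp : (1 : ℤ) ≤ p := by exact_mod_cast NeZero.one_le
  refine ⟨{x | (Int.divModEquiv p x).1 ∈ N (Int.divModEquiv p x).2}, ?_, fun i => ?_⟩
  · choose a b ha hb using hN
    have hx : ∀ x, (Int.divModEquiv p x).1 = x / p := fun _ => rfl
    have h1 : ∃ A : ℤ, A ≤ 0 ∧ ∀ i, A ≤ a i := by
      refine ⟨-∑ i, |a i|,
        by simpa using Finset.sum_nonneg fun i _ => abs_nonneg (a i), fun i => ?_⟩
      have := Finset.single_le_sum (fun i _ => abs_nonneg (a i)) (Finset.mem_univ i)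
      have := neg_abs_le (a i)
      omega
    have h2 : ∃ B : ℤ, 0 ≤ B ∧ ∀ i, b i ≤ B := by
      refine ⟨∑ i, |b i|, Finset.sum_nonneg fun i _ => abs_nonneg (b i), fun i => ?_⟩
      exact (le_abs_self _).trans
        (Finset.single_le_sum (fun i _ => abs_nonneg (b i)) (Finset.mem_univ i))
    obtain ⟨A, -, hA⟩ := h1
    obtain ⟨B, -, hB⟩ := h2
    refine ⟨A * p, B * p, fun x h => ha _ _ (lt_of_lt_of_le ?_ (hA _)),
      fun x h => hb _ _ ((hB _).trans ?_)⟩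
    · rw [hx]
      exact Int.ediv_lt_of_lt_mul (by omega) h
    · rw [hx]
      exact (Int.le_ediv_iff_mul_le (by omega)).2 h
  · ext m
    have h : Int.divModEquiv p (m * p + i) = (m, i) := (Int.divModEquiv p).apply_symm_apply (m, i)
    change (Int.divModEquiv p (m * p + i)).1 ∈ N (Int.divModEquiv p (m * p + i)).2 ↔ _
    rw [h]

theorem exists_charge_quotient {p : ℕ} [NeZero p] (μ : YoungDiagram) :
    ∃ x : {c : Fin p → ℤ // ∑ i, c i = 0} × (Fin p → YoungDiagram),
      ∀ i, splitMaya (maya μ 0) i = maya (x.2 i) (x.1.1 i) := by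
  choose l c h using fun i : Fin p => ((isMaya_maya μ 0).split i).exists_maya
  refine ⟨⟨⟨c, ?_⟩, l⟩, fun i => (h i).symm⟩
  have := mayaSum_one_split (p := p) (isMaya_maya μ 0)
  simp only [← h, mayaSum_one_maya] at this
  exact this.symm

/-- The charges and the quotients of the runners of the `p`-abacus of a Young diagram. -/
def abacus (p : ℕ) [NeZero p] (μ : YoungDiagram) :
    {c : Fin p → ℤ // ∑ i, c i = 0} × (Fin p → YoungDiagram) := (exists_charge_quotient μ).choose

theorem splitMaya_eq {p : ℕ} [NeZero p] (μ : YoungDiagram) (i : Fin p) :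
    splitMaya (maya μ 0) i = maya ((abacus p μ).2 i) ((abacus p μ).1.1 i) :=
  (exists_charge_quotient μ).choose_spec i

/-- Maya diagrams correspond to p-tuples of Maya diagrams, and each is given by a unique diagram and
charge. Charges add up under splitting, so charge 0 corresponds to sum 0. -/
theorem bijective_abacus (p : ℕ) [NeZero p] : Function.Bijective (abacus p) := by
  constructor
  · intro μ ν h
    refine (maya_injective (m := 0) (n := 0) (splitMaya_injective (p := p) ?_)).2
    funext i
    simp only [splitMaya_eq, h]
  · intro x
    obtain ⟨M, hM, hs⟩ := exists_splitMaya_eq (fun i => maya (x.2 i) (x.1.1 i))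
      fun i => isMaya_maya _ _
    obtain ⟨μ, n, rfl⟩ := hM.exists_maya
    have hn : n = 0 := by
      have := mayaSum_one_split (p := p) hM
      simp only [hs, mayaSum_one_maya] at this
      rw [this, x.1.2]
    subst hn
    refine ⟨μ, ?_⟩
    have h : ∀ i, (abacus p μ).1.1 i = x.1.1 i ∧ (abacus p μ).2 i = x.2 i := fun i =>
      maya_injective (by rw [← splitMaya_eq, hs])
    exact Prod.ext (Subtype.ext (funext fun i => (h i).1)) (funext fun i => (h i).2)

/-- The sum of the elements, with weights mp + i on the runner i, determines the size. The
contribution of the charges is separate from that of the quotients. -/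
theorem two_mul_card_eq (p : ℕ) [NeZero p] (μ : YoungDiagram) :
    2 * (μ.card : ℤ) = ∑ i : Fin p, ((abacus p μ).1.1 i * ((abacus p μ).1.1 i - 1) * p +
      2 * i * (abacus p μ).1.1 i) + 2 * (p * ∑ i : Fin p, ((abacus p μ).2 i).card) := by
  have h := two_mul_mayaSum_id_maya μ 0
  rw [mayaSum_split (p := p) (isMaya_maya μ 0), Finset.mul_sum] at h
  rw [zero_mul, add_zero] at h
  rw [← h, Nat.cast_sum, Finset.mul_sum, Finset.mul_sum, ← Finset.sum_add_distrib]
  refine Finset.sum_congr rfl fun i _ => ?_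
  rw [splitMaya_eq, mayaSum_linear (isMaya_maya _ _), mayaSum_one_maya]
  linear_combination (p : ℤ) *
    two_mul_mayaSum_id_maya ((abacus p μ).2 i) ((abacus p μ).1.1 i)

/-- Subtracting p moves an element one step down its own runner, so the core condition is closure
under m - 1 on every runner. -/
theorem isCore_iff_abacus (p : ℕ) [NeZero p] (μ : YoungDiagram) :
    IsCore p μ ↔ (abacus p μ).2 = fun _ => ⊥ := by
  rw [isCore_iff (NeZero.pos p), funext_iff]
  have e : ∀ i, (abacus p μ).2 i = ⊥ ↔
      ∀ m ∈ splitMaya (maya μ 0) i, m - 1 ∈ splitMaya (maya μ 0) i := fun i => by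
    rw [splitMaya_eq, maya_closed_iff]
  simp only [e]
  constructor
  · intro h i m hm
    have := h _ hm
    change (m - 1) * p + i ∈ maya μ 0
    convert this using 1
    ring
  · intro h x hx
    obtain ⟨⟨m, i⟩, rfl⟩ := (Int.divModEquiv p).symm.surjective x
    have := h i m hx
    change (m - 1) * p + i ∈ maya μ 0 at this
    change m * p + i - p ∈ maya μ 0
    convert this using 1
    ring

/-- The Young diagram with given charges and quotients on the runners of its `p`-abacus. -/
def ofAbacus (p : ℕ) [NeZero p] :
    {c : Fin p → ℤ // ∑ i, c i = 0} × (Fin p → YoungDiagram) ≃ YoungDiagram :=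
  (Equiv.ofBijective _ (bijective_abacus p)).symm

theorem abacus_ofAbacus {p : ℕ} [NeZero p]
    (x : {c : Fin p → ℤ // ∑ i, c i = 0} × (Fin p → YoungDiagram)) :
    abacus p (ofAbacus p x) = x := (Equiv.ofBijective _ (bijective_abacus p)).apply_symm_apply x

theorem card_ofAbacus {p : ℕ} [NeZero p] (c : {c : Fin p → ℤ // ∑ i, c i = 0})
    (l : Fin p → YoungDiagram) :
    (ofAbacus p (c, l)).card = (ofAbacus p (c, fun _ => ⊥)).card + p * ∑ i, (l i).card := by
  have h1 := two_mul_card_eq p (ofAbacus p (c, l))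
  have h2 := two_mul_card_eq p (ofAbacus p (c, fun _ => ⊥))
  rw [abacus_ofAbacus] at h1 h2
  have h3 : (⊥ : YoungDiagram).card = 0 := by simp [YoungDiagram.card]
  simp only [h3, Nat.cast_zero, Finset.sum_const_zero, mul_zero, add_zero] at h1 h2
  have : 2 * ((ofAbacus p (c, l)).card : ℤ) =
      2 * ((ofAbacus p (c, fun _ => ⊥)).card + p * ∑ i, (l i).card : ℕ) := by
    rw [Nat.cast_add, Nat.cast_mul]
    linear_combination h1 - h2
  omega

/-- The cores are parametrized by the charges. -/
def coreEquiv (p : ℕ) [NeZero p] :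
    {c : Fin p → ℤ // ∑ i, c i = 0} ≃ {μ : YoungDiagram // IsCore p μ} where
  toFun c := ⟨ofAbacus p (c, fun _ => ⊥), by rw [isCore_iff_abacus, abacus_ofAbacus]⟩
  invFun μ := (abacus p μ).1
  left_inv c := by simp only [abacus_ofAbacus]
  right_inv μ := by
    refine Subtype.ext ?_
    have h : ofAbacus p (abacus p μ) = μ := (ofAbacus p).apply_symm_apply _
    have h1 := (isCore_iff_abacus p μ).1 μ.2
    change ofAbacus p ((abacus p μ).1, fun _ => ⊥) = μ
    rw [← h1, Prod.mk.eta, h]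

/-- In Euler's series, the diagrams with given charges contribute q to the size of their core times
the p-th power of Euler's series at q^p. This common factor is divided out. -/
theorem hasSum_pow_card_core {p : ℕ} [NeZero p] {q : ℂ} (hq : ‖q‖ < 1) :
    HasSum (fun μ : {μ : YoungDiagram // IsCore p μ} => q ^ μ.1.card)
      (qPoch (q ^ p) (q ^ p) ^ p / qPoch q q) := by
  have hp : ‖q ^ p‖ < 1 := by
    rw [norm_pow]; exact pow_lt_one₀ (norm_nonneg _) hq (NeZero.ne p)
  have h1 := (ofAbacus p).hasSum_iff.2 (hasSum_pow_card hq).2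
  have h2 : HasSum (fun l : Fin p → YoungDiagram => ∏ i, (q ^ p) ^ (l i).card)
      ((qPoch (q ^ p) (q ^ p))⁻¹ ^ p) := by
    have h := (hasSum_fin_prod p (fun _ μ => (q ^ p) ^ YoungDiagram.card μ)
      fun _ => (hasSum_pow_card hp).1).2
    rwa [(hasSum_pow_card hp).2.tsum_eq, Finset.prod_const, Finset.card_univ, Fintype.card_fin] at h
  have h0 : qPoch (q ^ p) (q ^ p) ^ p ≠ 0 := pow_ne_zero _ (qPoch_self_ne_zero hp)
  have h3 : HasSum (fun c => q ^ (ofAbacus p (c, fun _ => ⊥)).card *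
      (qPoch (q ^ p) (q ^ p))⁻¹ ^ p) (qPoch q q)⁻¹ := by
    refine h1.prod_fiberwise fun c => ?_
    have e : (fun l => ((fun μ => q ^ YoungDiagram.card μ) ∘ ofAbacus p) (c, l)) =
        fun l => q ^ (ofAbacus p (c, fun _ => ⊥)).card * ∏ i, (q ^ p) ^ (l i).card := by
      funext l
      rw [Function.comp, card_ofAbacus, pow_add, pow_mul, Finset.prod_pow_eq_pow_sum]
    rw [e]
    exact h2.mul_left _
  have h4 := h3.mul_right (qPoch (q ^ p) (q ^ p) ^ p)
  simp only [inv_pow, inv_mul_cancel_right₀ h0] at h4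
  rw [← (coreEquiv p).hasSum_iff, div_eq_inv_mul]
  exact h4

theorem hasSum_coreCount (p : ℕ) [NeZero p] {q : ℂ} (hq : ‖q‖ < 1) :
    HasSum (fun n : ℕ => (coreCount p n : ℂ) * q ^ n)
      (qPoch (q ^ p) (q ^ p) ^ p / qPoch q q) := by
  refine ((hasSum_pow_card_core hq).tsum_fiberwise fun μ : {μ : YoungDiagram // IsCore p μ} =>
    μ.1.card).congr_fun fun n => ?_
  have h : ∀ b : (fun μ : {μ : YoungDiagram // IsCore p μ} => μ.1.card) ⁻¹' {n},
      q ^ b.1.1.card = q ^ n := fun b => congrArg (q ^ ·) b.2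
  -- The sum over the cores of size n is constant, so it is their number times q^n.
  rw [tsum_congr h, tsum_const, nsmul_eq_mul, Nat.card_coe_set_eq,
    ← ncard_image_of_injective _ Subtype.val_injective, coreCount]
  congr 3
  ext μ
  simp [and_comm]

end PCore

end

theorem mainTheorem8 (p : ℕ) [Fact p.Prime] (hp5 : 5 ≤ p) (hp19 : p ≤ 19)
    (γ : ℕ → CongruenceSubgroup.Gamma0 p)
    (hγ : ∀ a ∈ PCore.genIndices p, PCore.Represents (γ a) a)
    (τ : UpperHalfPlane) :
    PCore.nome τ ^ ((p ^ 2 - 1) / 24) *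
        (PCore.qPoch (PCore.nome τ ^ p) (PCore.nome τ ^ p) ^ p /
          PCore.qPoch (PCore.nome τ) (PCore.nome τ)) =
      ∏ a ∈ PCore.genIndices p, PCore.diamond 1 (γ a) (PCore.eisensteinMean p) τ ∧
    HasSum (fun n : ℕ => (PCore.coreCount p n : ℂ) * PCore.nome τ ^ n)
      (PCore.qPoch (PCore.nome τ ^ p) (PCore.nome τ ^ p) ^ p /
        PCore.qPoch (PCore.nome τ) (PCore.nome τ)) := by
  exact ⟨PCore.eisensteinMean_product p hp5 hp19 γ hγ τ,
    PCore.hasSum_coreCount p (PCore.norm_expo_lt_one τ.im_pos)⟩
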